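/- Let $S$ be a finite set of $n$ points in the Euclidean plane, $n$ even, no three of them collinear. The underlying geometric graph has vertex set $S$; two points $p\neq q$ of $S$ are joined by an edge iff $pq$ is a halving line, i.e. equally many points of $S$ lie strictly on either side of the line $pq$. Call a nonzero vector $u$ an orientation if no edge of the graph is parallel to $u$. Declare $u$ to be "up" ("vertical"), which gives meaning to left, right, above and below. The chains of $S$ for $u$ are obtained as follows. Start with a vertical line through one of the $n/2$ leftmost points of $S$ and rotate it clockwise about that point until it aligns with an edge or becomes vertical again. When it aligns with an edge, put that edge into the chain and go on rotating clockwise about the rightmost vertex of the chain so far; when it becomes vertical, stop. A common upper tangent of two chains is a line through two distinct vertices, one on each chain, such that all other vertices of the two chains lie strictly below it. Let $ab$ and $cd$ be two distinct edges which cross at a point $C$ that is interior to both. For an orientation $u$, a vertex pair $\{A,B\}$ is charged to this crossing if $AB$ is a common upper tangent of the chains that contain $ab$ and $cd$, $A$ and $B$ being its vertices on the two chains, and the vertical line through $C$ meets the segment $AB$. Then: 1. For every orientation $u$ there is exactly one vertex pair $f(C,u)$ charged to the crossing. 2. The angles between the lines $ab$ and $cd$ have exactly four bisecting rays, with directions $\pm\frac{b-a}{\|b-a\|}\pm\frac{d-c}{\|d-c\|}$,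 and the vertex pairs $f(C,u)$, for $u$ ranging over those of these four directions that are orientations, are pairwise distinct. In particular, if none of the four bisectors is parallel to an edge, they yield four distinct vertex pairs. 3. In any case, $f(C,u)$ takes at least four different values as $u$ ranges over all orientations. -/

import Mathlib

/-- The Euclidean plane. -/
abbrev Plane : Type := EuclideanSpace ℝ (Fin 2)

namespace HalvingLines

/-- The planar cross product; `0 < cross (q - p) (r - p)` says that `r` lies strictly to the left
of the line directed from `p` to `q`. -/
def cross (v w : Plane) : ℝ := v 0 * w 1 - v 1 * w 0

/-- General position: no three of the points are collinear. -/
def GeneralPosition (S : Finset Plane) : Prop :=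
  ∀ p ∈ S, ∀ q ∈ S, ∀ r ∈ S, p ≠ q → p ≠ r → q ≠ r → ¬ Collinear ℝ {p, q, r}

/-- The number of points of `S` strictly to the left of the line directed from `p` to `q`. -/
noncomputable def leftCount (S : Finset Plane) (p q : Plane) : ℕ :=
  (S.filter fun r => 0 < cross (q - p) (r - p)).card

theorem cross_swap (p q r : Plane) : cross (p - q) (r - q) = -cross (q - p) (r - p) := by
  simp only [cross, PiLp.sub_apply]
  ring

/-- The number of points of `S` strictly to the right of the line directed from `p` to `q`. -/
noncomputable def rightCount (S : Finset Plane) (p q : Plane) : ℕ :=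
  (S.filter fun r => cross (q - p) (r - p) < 0).card

/-- The underlying graph of `S`: two distinct points of `S` are joined by an edge iff the line
through them is a halving line, i.e. has equally many points of `S` strictly on either side. -/
noncomputable def underlyingGraph (S : Finset Plane) : SimpleGraph Plane where
  Adj p q := p ∈ S ∧ q ∈ S ∧ p ≠ q ∧ leftCount S p q = rightCount S p q
  symm := ⟨by
    rintro p q ⟨hp, hq, hne, h⟩
    refine ⟨hq, hp, hne.symm, ?_⟩
    have h1 : leftCount S q p = rightCount S p q := by
      simp only [leftCount, rightCount, cross_swap p q, neg_pos]
    have h2 : rightCount S q p = leftCount S p q := by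
      simp only [leftCount, rightCount, cross_swap p q, neg_neg_iff_pos]
    rw [h1, h2, h]⟩
  loopless := ⟨fun p h => h.2.2.1 rfl⟩

/-! ### Orientations

A nonzero vector `u` is used as the direction "up"; "right" is then `u` turned clockwise by a right
angle.  The two coordinates are scaled by the length of `u`, which is irrelevant to what follows. -/

/-- Horizontal (left-to-right) coordinate of `p` when `u` points up. -/
def xCoord (u p : Plane) : ℝ := p 0 * u 1 - p 1 * u 0

/-- Vertical coordinate of `p` when `u` points up. -/
def yCoord (u p : Plane) : ℝ := p 0 * u 0 + p 1 * u 1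

/-- Slope of the line `pq` when `u` points up. -/
noncomputable def slope (u p q : Plane) : ℝ :=
  (yCoord u q - yCoord u p) / (xCoord u q - xCoord u p)

/-- `u` can serve as the direction "up": it is not zero and no edge of the underlying graph is
vertical. -/
def IsOrientation (S : Finset Plane) (u : Plane) : Prop :=
  u ≠ 0 ∧ ∀ p q, (underlyingGraph S).Adj p q → xCoord u p ≠ xCoord u q

/-- `p` is one of the `n / 2` leftmost of the `n` points of `S`. -/
def InLeftHalf (S : Finset Plane) (u p : Plane) : Prop :=
  p ∈ S ∧ 2 * (S.filter fun q => xCoord u q < xCoord u p).card < S.card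

/-! ### Chains -/

/-- A line through `p` is rotated clockwise about `p`, starting at slope `m` (`⊤` is the vertical
line) and ending when it becomes vertical again.  The first edge it aligns with after
the start is `pq`. -/
def FirstEdge (S : Finset Plane) (u p : Plane) (m : WithTop ℝ) (q : Plane) : Prop :=
  (underlyingGraph S).Adj p q ∧ (slope u p q : WithTop ℝ) < m ∧
    ∀ r, (underlyingGraph S).Adj p r → (slope u p r : WithTop ℝ) < m → slope u p r ≤ slope u p q

/-- The right one of two points. -/
noncomputable def rightmost (u p q : Plane) : Plane :=
  if xCoord u p < xCoord u q then q else p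

/-- The states of the chain construction begun at `p₀`: in state `(p, m)` the rotating line passes
through the pivot `p` with slope `m`.  The first line is vertical.  Whenever the line aligns with an
edge, the rotation goes on about the rightmost vertex so far. -/
inductive ChainState (S : Finset Plane) (u p₀ : Plane) : Plane → WithTop ℝ → Prop
  | start : ChainState S u p₀ p₀ ⊤
  | step {p : Plane} {m : WithTop ℝ} {q : Plane} (h : ChainState S u p₀ p m)
      (hq : FirstEdge S u p m q) : ChainState S u p₀ (rightmost u p q) (slope u p q)

/-- The set of edges that the construction begun at `p₀` collects. -/
def chainEdges (S : Finset Plane) (u p₀ : Plane) : Set (Sym2 Plane) :=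
  {e | ∃ p m q, ChainState S u p₀ p m ∧ FirstEdge S u p m q ∧ e = s(p, q)}

/-- `c` is (the edge set of) a chain of `S` when `u` points up. -/
def IsChain (S : Finset Plane) (u : Plane) (c : Set (Sym2 Plane)) : Prop :=
  ∃ p₀, InLeftHalf S u p₀ ∧ c = chainEdges S u p₀

/-- The vertices on a chain. -/
def chainVertices (c : Set (Sym2 Plane)) : Set Plane := {v | ∃ e ∈ c, v ∈ e}

/-! ### Crossings and upper tangents -/

/-- The distinct edges `ab` and `cd` cross at `C`, a point in the relative interior of both. -/
def IsCrossing (S : Finset Plane) (a b c d C : Plane) : Prop :=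
  (underlyingGraph S).Adj a b ∧ (underlyingGraph S).Adj c d ∧ s(a, b) ≠ s(c, d) ∧
    C ∈ openSegment ℝ a b ∧ C ∈ openSegment ℝ c d

/-- `z` lies strictly below the non-vertical line `AB`. -/
def StrictlyBelow (u A B z : Plane) : Prop :=
  yCoord u z < yCoord u A + slope u A B * (xCoord u z - xCoord u A)

/-- The line `AB` is a common upper tangent of the chains `c₁` and `c₂`, where `A` is a vertex
of `c₁` and `B` is a vertex of `c₂`: the rest of the two chains is strictly below it. -/
def IsCommonUpperTangent (u : Plane) (c₁ c₂ : Set (Sym2 Plane)) (A B : Plane) : Prop :=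
  A ∈ chainVertices c₁ ∧ B ∈ chainVertices c₂ ∧ xCoord u A ≠ xCoord u B ∧
    ∀ z ∈ chainVertices c₁ ∪ chainVertices c₂, z ≠ A → z ≠ B → StrictlyBelow u A B z

/-- When `u` points up, the vertex pair `P` is charged to the crossing `C` of the edges
`e₁` and `e₂`: it spans a common upper tangent of the chains that contain `e₁` and `e₂`, and the
vertical line through `C` meets this tangent between its two vertices. -/
def IsCharged (S : Finset Plane) (u : Plane) (e₁ e₂ : Sym2 Plane) (C : Plane)
    (P : Sym2 Plane) : Prop :=
  ∃ c₁ c₂, IsChain S u c₁ ∧ IsChain S u c₂ ∧ e₁ ∈ c₁ ∧ e₂ ∈ c₂ ∧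
    ∃ A B, P = s(A, B) ∧ IsCommonUpperTangent u c₁ c₂ A B ∧
      ∃ z ∈ segment ℝ A B, xCoord u z = xCoord u C

/-- The directions of the four rays that bisect the angles between the lines `ab` and `cd`: the sums
of a unit vector along `ab` and a unit vector along `cd`, with all choices of signs. -/
def bisectors (a b c d : Plane) : Set Plane :=
  {u | ∃ σ τ : ℝ, (σ = 1 ∨ σ = -1) ∧ (τ = 1 ∨ τ = -1) ∧
    u = (σ / ‖b - a‖) • (b - a) + (τ / ‖d - c‖) • (d - c)}

end HalvingLines

/-! ### Coordinates for a direction `u`, and the balance of a line rotating about a point. -/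

namespace HalvingLines

open Filter Topology

variable {S : Finset Plane} {u p q r : Plane} {m : ℝ}

/-! For a line through `p` in `S`, `balance` counts points above minus points below. As `n` is even,
it is odd unless the line contains a second point; so while the line rotates, the sign of the
balance changes only at edges. Next to an edge `pq` only `q` is off balance, and the sign tells on
which side of `p` it lies. Hence edges at `p` that are consecutive in slope leave on opposite sides
(`alternate`), and the steepest one goes right exactly when `p` is in the left half. Thus chains are
concave paths running to the right, each edge lies on exactly one of them (`exists_isChain`,
`isChain_unique`), and a chain stays below the line of each of its edges (`isChain_supports`).

Given a crossing `C`, take the edge `AB` of the upper hull of both chains that passes over `C`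
(`exists_upper_tangent`). `C` is strictly below `AB`, for otherwise both crossing edges would equal
`AB`. If `A` and `B` were on one chain, `AB` would lie below the line of that chain's crossing edge
and could not pass above `C`. So the ends lie on different chains. Two such tangents support each
other and therefore coincide.

`A` is below line `ab`, `B` is below line `cd` and `C` is below `AB`, so the slope of `AB` lies
strictly between those of `ab` and `cd` (`isCharged_props`). The directions of `ab` and `cd` bound
two double wedges, and `u` and `AB` lie in different ones; so the pair determines the double wedge
of `u`. Opposite orientations give pairs on opposite sides of `C`. Hence `u`, `-u` and two opposite
directions of the other double wedge give four pairs. -/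

theorem coords_cross (u p q r : Plane) :
    (xCoord u q - xCoord u p) * (yCoord u r - yCoord u p) -
      (yCoord u q - yCoord u p) * (xCoord u r - xCoord u p) =
    (u 0 ^ 2 + u 1 ^ 2) * cross (q - p) (r - p) := by
  simp only [xCoord, yCoord, cross, PiLp.sub_apply]
  ring

theorem normSq_coords_pos (hu : u ≠ 0) : 0 < u 0 ^ 2 + u 1 ^ 2 := by
  by_contra! h
  apply hu
  ext i
  fin_cases i
  · simpa using (by nlinarith [sq_nonneg (u 0), sq_nonneg (u 1)] : u 0 = 0)
  · simpa using (by nlinarith [sq_nonneg (u 0), sq_nonneg (u 1)] : u 1 = 0)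

theorem eq_of_coords (hu : u ≠ 0) (hx : xCoord u p = xCoord u q) (hy : yCoord u p = yCoord u q) :
    p = q := by
  have h := normSq_coords_pos hu
  simp only [xCoord, yCoord] at hx hy
  have h0 : (u 0 ^ 2 + u 1 ^ 2) * (p 0 - q 0) = 0 := by linear_combination u 1 * hx + u 0 * hy
  have h1 : (u 0 ^ 2 + u 1 ^ 2) * (p 1 - q 1) = 0 := by linear_combination u 1 * hy - u 0 * hx
  ext i
  fin_cases i
  · simpa [h.ne', sub_eq_zero] using h0
  · simpa [h.ne', sub_eq_zero] using h1

theorem cross_ne_zero (hGen : GeneralPosition S) (hp : p ∈ S) (hq : q ∈ S) (hr : r ∈ S)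
    (hpq : p ≠ q) (hpr : p ≠ r) (hqr : q ≠ r) : cross (q - p) (r - p) ≠ 0 := by
  intro h
  refine hGen p hp q hq r hr hpq hpr hqr ?_
  have hn := normSq_coords_pos (sub_ne_zero.2 hpq.symm)
  rw [collinear_iff_of_mem (p₀ := p) (by simp)]
  refine ⟨q - p, ?_⟩
  simp only [Set.mem_insert_iff, Set.mem_singleton_iff, forall_eq_or_imp, forall_eq]
  -- The multiplier is the coefficient of the orthogonal projection of `r - p` onto `q - p`.
  refine ⟨⟨0, by simp⟩, ⟨1, by simp⟩, ⟨((r - p) 0 * (q - p) 0 + (r - p) 1 * (q - p) 1) /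
    ((q - p) 0 ^ 2 + (q - p) 1 ^ 2), ?_⟩⟩
  rw [vadd_eq_add, ← sub_eq_iff_eq_add]
  simp only [cross] at h
  ext i
  rw [PiLp.smul_apply, smul_eq_mul, div_mul_eq_mul_div, eq_div_iff hn.ne']
  fin_cases i
  · simp only [Fin.zero_eta]
    linear_combination -(q - p) 1 * h
  · simp only [Fin.mk_one]
    linear_combination (q - p) 0 * h

/-- The height of `r` above the line of slope `m` through `p`. -/
def excess (u p : Plane) (m : ℝ) (r : Plane) : ℝ :=
  yCoord u r - yCoord u p - m * (xCoord u r - xCoord u p)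

/-- The number of points of `S` above the line of slope `m` through `p` minus the number of those
below it. -/
noncomputable def balance (S : Finset Plane) (u p : Plane) (m : ℝ) : ℤ :=
  ∑ r ∈ S, (SignType.sign (excess u p m r) : ℤ)

theorem slope_comm (u p q : Plane) : slope u p q = slope u q p := by
  rw [slope, slope, ← neg_sub (yCoord u p), ← neg_sub (xCoord u p), neg_div_neg_eq]

theorem excess_eq_zero_iff (hx : xCoord u p ≠ xCoord u q) :
    excess u p m q = 0 ↔ slope u p q = m := by
  have : xCoord u q - xCoord u p ≠ 0 := sub_ne_zero.2 hx.symm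
  rw [slope, div_eq_iff this, excess, sub_eq_zero]

theorem slope_mul (hx : xCoord u p ≠ xCoord u q) :
    slope u p q * (xCoord u q - xCoord u p) = yCoord u q - yCoord u p := by
  have : xCoord u q - xCoord u p ≠ 0 := sub_ne_zero.2 hx.symm
  rw [slope, div_mul_cancel₀ _ this]

theorem cross_eq_excess (hx : xCoord u p ≠ xCoord u q) :
    (u 0 ^ 2 + u 1 ^ 2) * cross (q - p) (r - p) =
      (xCoord u q - xCoord u p) * excess u p (slope u p q) r := by
  rw [← coords_cross, ← slope_mul hx, excess]
  ring

theorem excess_ne_zero (hGen : GeneralPosition S) (hu : u ≠ 0) (hp : p ∈ S) (hq : q ∈ S)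
    (hr : r ∈ S) (hx : xCoord u p ≠ xCoord u q) (hpr : r ≠ p) (hqr : r ≠ q) :
    excess u p (slope u p q) r ≠ 0 := by
  intro h
  have h1 := cross_eq_excess (r := r) hx
  rw [h, mul_zero] at h1
  exact cross_ne_zero hGen hp hq hr (by rintro rfl; exact hx rfl) hpr.symm hqr.symm
    ((mul_eq_zero.1 h1).resolve_left (normSq_coords_pos hu).ne')

/-- Two points seen from `p` under the same slope coincide. -/
theorem eq_of_slope_eq (hGen : GeneralPosition S) (hu : u ≠ 0) (hp : p ∈ S) (hq : q ∈ S)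
    (hr : r ∈ S) (hq' : xCoord u p ≠ xCoord u q) (hr' : xCoord u p ≠ xCoord u r)
    (h : slope u p q = slope u p r) : q = r := by
  by_contra hne
  exact excess_ne_zero hGen hu hp hq hr hq' (by rintro rfl; exact hr' rfl) (Ne.symm hne)
    ((excess_eq_zero_iff hr').2 h.symm)

theorem sum_sign_eq_card_sub_card (S : Finset Plane) (g : Plane → ℝ) :
    ∑ r ∈ S, (SignType.sign (g r) : ℤ) =
      (S.filter fun r => 0 < g r).card - (S.filter fun r => g r < 0).card := by
  rw [Finset.card_filter, Finset.card_filter]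
  push_cast
  rw [← Finset.sum_sub_distrib]
  refine Finset.sum_congr rfl fun r _ => ?_
  rcases lt_trichotomy (g r) 0 with h | h | h
  · simp [h, not_lt.2 h.le]
  · simp [h]
  · simp [h, not_lt.2 h.le]

theorem card_eq_pos_add_neg_add_zero (S : Finset Plane) (g : Plane → ℝ) :
    S.card = (S.filter fun r => 0 < g r).card + (S.filter fun r => g r < 0).card +
      (S.filter fun r => g r = 0).card := by
  rw [Finset.card_filter, Finset.card_filter, Finset.card_filter, Finset.card_eq_sum_ones,
    ← Finset.sum_add_distrib, ← Finset.sum_add_distrib]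
  refine Finset.sum_congr rfl fun r _ => ?_
  rcases lt_trichotomy (g r) 0 with h | h | h
  · simp [h, h.ne, not_lt.2 h.le]
  · simp [h]
  · simp [h, h.ne', not_lt.2 h.le]

theorem sub_eq_sum_sign_cross (S : Finset Plane) (p q : Plane) :
    (leftCount S p q : ℤ) - rightCount S p q =
      ∑ r ∈ S, (SignType.sign (cross (q - p) (r - p)) : ℤ) := by
  rw [sum_sign_eq_card_sub_card, leftCount, rightCount]

/-- Left and right of the directed line are above and below, interchanged if `q` is to the left of
`p`; this does not affect vanishing. -/
theorem counts_eq_iff_balance (hu : u ≠ 0) (hx : xCoord u p ≠ xCoord u q) :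
    leftCount S p q = rightCount S p q ↔ balance S u p (slope u p q) = 0 := by
  have key : ∀ r, SignType.sign (cross (q - p) (r - p)) =
      SignType.sign (xCoord u q - xCoord u p) *
        SignType.sign (excess u p (slope u p q) r) := by
    intro r
    rw [← sign_mul, ← cross_eq_excess hx, sign_mul, sign_pos (normSq_coords_pos hu), one_mul]
  rw [← Nat.cast_inj (R := ℤ), ← sub_eq_zero, sub_eq_sum_sign_cross, balance]
  simp only [key, SignType.coe_mul, ← Finset.mul_sum]
  rw [mul_eq_zero, or_iff_right]
  have := sub_ne_zero.2 hx.symm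
  rcases this.lt_or_gt with h | h <;> simp [h]

theorem adj_iff_balance (hu : u ≠ 0) (hp : p ∈ S) (hq : q ∈ S)
    (hx : xCoord u p ≠ xCoord u q) :
    (underlyingGraph S).Adj p q ↔ balance S u p (slope u p q) = 0 := by
  rw [← counts_eq_iff_balance hu hx]
  exact ⟨fun h => h.2.2.2, fun h => ⟨hp, hq, by rintro rfl; exact hx rfl, h⟩⟩

theorem excess_self (u p : Plane) (m : ℝ) : excess u p m p = 0 := by simp [excess]

theorem x_ne_of_excess_eq_zero (hu : u ≠ 0) (hne : r ≠ p) (h : excess u p m r = 0) :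
    xCoord u p ≠ xCoord u r := by
  intro hx
  rw [excess, hx, sub_self, mul_zero, sub_zero, sub_eq_zero] at h
  exact hne (eq_of_coords hu hx.symm h)

/-- A line through `p` contains at most one other point of `S`. -/
theorem zeros_eq (hGen : GeneralPosition S) (hu : u ≠ 0) (hp : p ∈ S) (m : ℝ) :
    (S.filter fun r => excess u p m r = 0) = {p} ∨
      ∃ t ∈ S, t ≠ p ∧ xCoord u p ≠ xCoord u t ∧ slope u p t = m ∧
        (S.filter fun r => excess u p m r = 0) = {p, t} := by
  by_cases h : ∃ t ∈ S, t ≠ p ∧ excess u p m t = 0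
  · obtain ⟨t, ht, htp, h0⟩ := h
    have hx := x_ne_of_excess_eq_zero hu htp h0
    have hs := (excess_eq_zero_iff hx).1 h0
    refine Or.inr ⟨t, ht, htp, hx, hs, ?_⟩
    ext r
    simp only [Finset.mem_filter, Finset.mem_insert, Finset.mem_singleton]
    constructor
    · rintro ⟨hr, hr0⟩
      by_contra! hne
      rw [← hs] at hr0
      exact excess_ne_zero hGen hu hp ht hr hx hne.1 hne.2 hr0
    · rintro (rfl | rfl)
      · exact ⟨hp, excess_self _ _ _⟩
      · exact ⟨ht, h0⟩
  · push Not at h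
    left
    ext r
    simp only [Finset.mem_filter, Finset.mem_singleton]
    constructor
    · rintro ⟨hr, hr0⟩
      by_contra hne
      exact h r hr hne hr0
    · rintro rfl
      exact ⟨hp, excess_self _ _ _⟩

/-- Above minus below has the parity of above plus below, which is `n` minus the number of points on
the line. -/
theorem even_balance_iff (hEven : Even S.card) (u p : Plane) (m : ℝ) :
    Even (balance S u p m) ↔ Even (S.filter fun r => excess u p m r = 0).card := by
  have h1 := sum_sign_eq_card_sub_card S (excess u p m)
  have h2 := card_eq_pos_add_neg_add_zero S (excess u p m)
  rw [balance, h1]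
  rw [h2] at hEven
  rw [Int.even_iff, Nat.even_iff]
  rw [Nat.even_iff] at hEven
  omega

/-- If `p` were alone on the line, the balance would be odd. -/
theorem exists_adj_of_balance_eq_zero (hEven : Even S.card) (hGen : GeneralPosition S) (hu : u ≠ 0)
    (hp : p ∈ S) (h : balance S u p m = 0) :
    ∃ q, (underlyingGraph S).Adj p q ∧ slope u p q = m := by
  rcases zeros_eq hGen hu hp m with h0 | ⟨t, ht, htp, hx, hs, -⟩
  · have := (even_balance_iff hEven u p m).1 (by simp [h])
    simp [h0] at this
  · exact ⟨t, (adj_iff_balance hu hp ht hx).2 (by rwa [hs]), hs⟩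

theorem continuous_excess (u p r : Plane) : Continuous fun m => excess u p m r := by
  unfold excess
  fun_prop

/-- Near slope `m` only the points on the line of slope `m` can change sides. -/
theorem eventually_balance_eq (S : Finset Plane) (u p : Plane) (m : ℝ) :
    ∀ᶠ m' in 𝓝 m, balance S u p m' = balance S u p m +
      ∑ r ∈ S.filter (fun r => excess u p m r = 0), (SignType.sign (excess u p m' r) : ℤ) := by
  have h : ∀ᶠ m' in 𝓝 m, ∀ r ∈ S, excess u p m r ≠ 0 →
      SignType.sign (excess u p m' r) = SignType.sign (excess u p m r) := by
    rw [Filter.eventually_all_finset]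
    intro r _
    by_cases h0 : excess u p m r = 0
    · simp [h0]
    have hc := (continuous_excess u p r).tendsto m
    rcases lt_or_gt_of_ne h0 with h | h
    · filter_upwards [hc.eventually (eventually_lt_nhds h)] with m' hm' _
      rw [sign_neg hm', sign_neg h]
    · filter_upwards [hc.eventually (eventually_gt_nhds h)] with m' hm' _
      rw [sign_pos hm', sign_pos h]
  filter_upwards [h] with m' hm'
  rw [balance, balance, Finset.sum_filter, ← Finset.sum_add_distrib]
  refine Finset.sum_congr rfl fun r hr => ?_
  by_cases h0 : excess u p m r = 0
  · simp [h0]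
  · simp [h0, hm' r hr h0]

/-- With `p` alone on the line, the balance is locally constant. With a second point it is even and
nonzero, so at least 2 in absolute value, and that point changes it by at most 1. -/
theorem sign_eventually_eq (hEven : Even S.card) (hGen : GeneralPosition S) (hu : u ≠ 0)
    (hp : p ∈ S) (h : balance S u p m ≠ 0) :
    ∀ᶠ m' in 𝓝 m, SignType.sign (balance S u p m') = SignType.sign (balance S u p m) := by
  have he := even_balance_iff hEven u p m
  filter_upwards [eventually_balance_eq S u p m] with m' hm'
  rw [hm']
  rcases zeros_eq hGen hu hp m with h0 | ⟨t, ht, htp, hx, hs, h0⟩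
  · rw [h0]
    simp [excess_self]
  · rw [h0, Finset.card_pair htp.symm] at he
    obtain ⟨k, hk⟩ := he.2 (by decide)
    rw [h0, Finset.sum_pair htp.symm, excess_self, sign_zero, SignType.coe_zero, zero_add]
    have h1 : (SignType.sign (excess u p m' t) : ℤ) = -1 ∨
        (SignType.sign (excess u p m' t) : ℤ) = 0 ∨
        (SignType.sign (excess u p m' t) : ℤ) = 1 := by
      rcases lt_trichotomy (excess u p m' t) 0 with h | h | h <;> simp [h]
    rcases h.lt_or_gt with h | h
    · rw [sign_neg h, sign_neg (by omega)]
    · rw [sign_pos h, sign_pos (by omega)]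

theorem sign_balance_eq_of_no_edge (hEven : Even S.card) (hGen : GeneralPosition S) (hu : u ≠ 0)
    (hp : p ∈ S) {I : Set ℝ} (hI : I.OrdConnected)
    (h : ∀ q, (underlyingGraph S).Adj p q → slope u p q ∉ I) {m₁ m₂ : ℝ} (h₁ : m₁ ∈ I)
    (h₂ : m₂ ∈ I) : SignType.sign (balance S u p m₁) = SignType.sign (balance S u p m₂) := by
  refine hI.isPreconnected.constant (f := fun m => SignType.sign (balance S u p m)) ?_ h₁ h₂
  intro m hm
  refine ContinuousAt.continuousWithinAt (Filter.EventuallyEq.continuousAt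
    (y := SignType.sign (balance S u p m)) ?_)
  refine sign_eventually_eq hEven hGen hu hp fun h0 => ?_
  obtain ⟨q, hq, hs⟩ := exists_adj_of_balance_eq_zero hEven hGen hu hp h0
  exact h q hq (hs ▸ hm)

/-- The balance vanishes on the edge itself, so after a small rotation only `q` contributes. -/
theorem eventually_balance_of_adj (hGen : GeneralPosition S) (hu : u ≠ 0)
    (h : (underlyingGraph S).Adj p q) (hx : xCoord u p ≠ xCoord u q) :
    ∀ᶠ m' in 𝓝 (slope u p q), balance S u p m' =
      SignType.sign ((slope u p q - m') * (xCoord u q - xCoord u p)) := by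
  have hb := (adj_iff_balance hu h.1 h.2.1 hx).1 h
  filter_upwards [eventually_balance_eq S u p (slope u p q)] with m' hm'
  have h0 : (S.filter fun r => excess u p (slope u p q) r = 0) = {p, q} := by
    ext r
    simp only [Finset.mem_filter, Finset.mem_insert, Finset.mem_singleton]
    constructor
    · rintro ⟨hr, hr0⟩
      by_contra! hne
      exact excess_ne_zero hGen hu h.1 h.2.1 hr hx hne.1 hne.2 hr0
    · rintro (rfl | rfl)
      · exact ⟨h.1, excess_self _ _ _⟩
      · exact ⟨h.2.1, (excess_eq_zero_iff hx).2 rfl⟩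
  rw [hm', hb, h0, Finset.sum_pair h.ne, excess_self, sign_zero, SignType.coe_zero, zero_add,
    zero_add, excess, ← slope_mul hx, sub_mul]

end HalvingLines

/-! ### Alternation of edges at a point; every edge lies on a chain. -/

namespace HalvingLines

open Filter Topology

variable {S : Finset Plane} {u p q r : Plane} {m : ℝ}

theorem sign_balance_above (hEven : Even S.card) (hGen : GeneralPosition S) (hu : u ≠ 0)
    (h : (underlyingGraph S).Adj p q) (hx : xCoord u p ≠ xCoord u q) {I : Set ℝ}
    (hI : I.OrdConnected) (hI' : I ∈ 𝓝[>] (slope u p q))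
    (hno : ∀ r, (underlyingGraph S).Adj p r → slope u p r ∉ I) (hm : m ∈ I) :
    SignType.sign (balance S u p m) = SignType.sign (xCoord u p - xCoord u q) := by
  -- The slope `m'` is in `I` and near enough to the edge for the local formula; the sign there is
  -- the sign on all of `I`.
  obtain ⟨m', h1, h2, h3⟩ := ((eventually_nhdsWithin_of_eventually_nhds
    (eventually_balance_of_adj hGen hu h hx)).and
    ((show ∀ᶠ m' in 𝓝[>] (slope u p q), m' ∈ I from hI').and self_mem_nhdsWithin)).exists
  rw [sign_balance_eq_of_no_edge hEven hGen hu h.1 hI hno hm h2, h1, sign_mul,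
    sign_neg (sub_neg.2 h3), ← neg_sub (xCoord u q), Left.sign_neg (xCoord u q - _)]
  rcases lt_or_gt_of_ne (sub_ne_zero.2 hx.symm) with h | h <;> simp [sign_neg, sign_pos, h]

theorem sign_balance_below (hEven : Even S.card) (hGen : GeneralPosition S) (hu : u ≠ 0)
    (h : (underlyingGraph S).Adj p q) (hx : xCoord u p ≠ xCoord u q) {I : Set ℝ}
    (hI : I.OrdConnected) (hI' : I ∈ 𝓝[<] (slope u p q))
    (hno : ∀ r, (underlyingGraph S).Adj p r → slope u p r ∉ I) (hm : m ∈ I) :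
    SignType.sign (balance S u p m) = SignType.sign (xCoord u q - xCoord u p) := by
  obtain ⟨m', h1, h2, h3⟩ := ((eventually_nhdsWithin_of_eventually_nhds
    (eventually_balance_of_adj hGen hu h hx)).and
    ((show ∀ᶠ m' in 𝓝[<] (slope u p q), m' ∈ I from hI').and self_mem_nhdsWithin)).exists
  rw [sign_balance_eq_of_no_edge hEven hGen hu h.1 hI hno hm h2, h1, sign_mul,
    sign_pos (sub_pos.2 h3), one_mul]
  rcases lt_or_gt_of_ne (sub_ne_zero.2 hx.symm) with h | h <;> simp [sign_neg, sign_pos, h]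

/-- Edges at `p` that are consecutive in slope leave `p` on different sides. -/
theorem alternate (hEven : Even S.card) (hGen : GeneralPosition S) (hu : IsOrientation S u)
    (hq : (underlyingGraph S).Adj p q) (hr : (underlyingGraph S).Adj p r)
    (hlt : slope u p r < slope u p q)
    (hno : ∀ t, (underlyingGraph S).Adj p t → slope u p t < slope u p q →
      slope u p t ≤ slope u p r) :
    xCoord u q < xCoord u p ↔ xCoord u p < xCoord u r := by
  have hno' : ∀ t, (underlyingGraph S).Adj p t →
      slope u p t ∉ Set.Ioo (slope u p r) (slope u p q) :=
    fun t ht h => (hno t ht h.2).not_gt h.1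
  obtain ⟨m, hm⟩ := Set.nonempty_Ioo.2 hlt
  have h1 := sign_balance_below hEven hGen hu.1 hq (hu.2 _ _ hq) Set.ordConnected_Ioo
    (Ioo_mem_nhdsLT hlt) hno' hm
  have h2 := sign_balance_above hEven hGen hu.1 hr (hu.2 _ _ hr) Set.ordConnected_Ioo
    (Ioo_mem_nhdsGT hlt) hno' hm
  rw [h1] at h2
  rw [← sub_neg, ← sign_eq_neg_one_iff, h2, sign_eq_neg_one_iff, sub_neg]

theorem eventually_sign_excess_atTop (h : xCoord u p ≠ xCoord u r) :
    ∀ᶠ m in atTop, SignType.sign (excess u p m r) =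
      SignType.sign (xCoord u p - xCoord u r) := by
  filter_upwards [eventually_gt_atTop (slope u p r)] with m hm
  have h1 : excess u p m r = (m - slope u p r) * (xCoord u p - xCoord u r) := by
    rw [excess, ← slope_mul h]
    ring
  rw [h1, sign_mul, sign_pos (sub_pos.2 hm), one_mul]

/-- A steep line through `p` has more points below than above iff `p` is in the left half. -/
theorem eventually_balance_neg_iff (hEven : Even S.card) (hGen : GeneralPosition S)
    (hu : IsOrientation S u) (hp : p ∈ S) :
    ∀ᶠ m in atTop, (balance S u p m < 0 ↔ InLeftHalf S u p) := by
  have h : ∀ᶠ m in atTop, ∀ r ∈ S, xCoord u p - xCoord u r ≠ 0 →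
      SignType.sign (excess u p m r) = SignType.sign (xCoord u p - xCoord u r) := by
    rw [Filter.eventually_all_finset]
    intro r _
    by_cases h0 : xCoord u p - xCoord u r = 0
    · simp [h0]
    · filter_upwards [eventually_sign_excess_atTop (sub_ne_zero.1 h0)] with m hm _ using hm
  filter_upwards [h] with m hm
  -- A steep line has the points to the left of `p` above it and those to the right below it; points
  -- on the vertical line through `p` count by height.
  have hsum : balance S u p m = ∑ r ∈ S, (SignType.sign (xCoord u p - xCoord u r) : ℤ) +
      ∑ r ∈ S.filter (fun r => xCoord u p - xCoord u r = 0),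
        (SignType.sign (yCoord u r - yCoord u p) : ℤ) := by
    rw [balance, Finset.sum_filter, ← Finset.sum_add_distrib]
    refine Finset.sum_congr rfl fun r hr => ?_
    by_cases h0 : xCoord u p - xCoord u r = 0
    · have : xCoord u r - xCoord u p = 0 := by linarith
      simp [h0, excess, this]
    · simp [h0, hm r hr h0]
  have h1 := sum_sign_eq_card_sub_card S fun r => xCoord u p - xCoord u r
  have h2 := card_eq_pos_add_neg_add_zero S fun r => xCoord u p - xCoord u r
  have hL : (S.filter fun r => 0 < xCoord u p - xCoord u r) =
      S.filter fun q => xCoord u q < xCoord u p := by simp only [sub_pos]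
  rw [InLeftHalf, and_iff_right hp, ← hL]
  obtain ⟨k, hk⟩ := hEven
  by_cases hv : ∃ t ∈ S, t ≠ p ∧ xCoord u p = xCoord u t
  · obtain ⟨t, ht, htp, hx⟩ := hv
    have hy : yCoord u t - yCoord u p ≠ 0 := fun h =>
      htp (eq_of_coords hu.1 hx.symm (sub_eq_zero.1 h))
    have hcr : ∀ r, (u 0 ^ 2 + u 1 ^ 2) * cross (t - p) (r - p) =
        (yCoord u t - yCoord u p) * (xCoord u p - xCoord u r) := by
      intro r
      rw [← coords_cross, hx]
      ring
    have h0 : (S.filter fun r => xCoord u p - xCoord u r = 0) = {p, t} := by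
      ext r
      simp only [Finset.mem_filter, Finset.mem_insert, Finset.mem_singleton]
      constructor
      · rintro ⟨hr, hr0⟩
        by_contra! hne
        have := hcr r
        rw [hr0, mul_zero] at this
        exact cross_ne_zero hGen hp ht hr htp.symm hne.1.symm hne.2.symm
          ((mul_eq_zero.1 this).resolve_left (normSq_coords_pos hu.1).ne')
      · rintro (rfl | rfl)
        · exact ⟨hp, sub_self _⟩
        · exact ⟨ht, sub_eq_zero.2 hx⟩
    -- Otherwise the vertical line `pt` would be an edge. The sum is even by parity of `n`, so being
    -- nonzero it outweighs the contribution of `t`.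
    have hne : ∑ r ∈ S, (SignType.sign (xCoord u p - xCoord u r) : ℤ) ≠ 0 := by
      intro hs
      refine hu.2 p t ⟨hp, ht, htp.symm, ?_⟩ hx
      rw [← Nat.cast_inj (R := ℤ), ← sub_eq_zero, sub_eq_sum_sign_cross]
      have key : ∀ r, SignType.sign (cross (t - p) (r - p)) =
          SignType.sign (yCoord u t - yCoord u p) *
            SignType.sign (xCoord u p - xCoord u r) := by
        intro r
        rw [← sign_mul, ← hcr, sign_mul, sign_pos (normSq_coords_pos hu.1), one_mul]
      simp only [key, SignType.coe_mul, ← Finset.mul_sum, hs, mul_zero]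
    rw [h0, Finset.card_pair htp.symm] at h2
    rw [h0, Finset.sum_pair htp.symm, sub_self, sign_zero, SignType.coe_zero, zero_add] at hsum
    have h3 : (SignType.sign (yCoord u t - yCoord u p) : ℤ) = -1 ∨
        (SignType.sign (yCoord u t - yCoord u p) : ℤ) = 1 := by
      rcases hy.lt_or_gt with h | h
      · simp [sign_neg h]
      · simp [sign_pos h]
    omega
  · have h0 : (S.filter fun r => xCoord u p - xCoord u r = 0) = {p} := by
      ext r
      simp only [Finset.mem_filter, Finset.mem_singleton]
      constructor
      · rintro ⟨hr, hr0⟩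
        by_contra hne
        exact hv ⟨r, hr, hne, sub_eq_zero.1 hr0⟩
      · rintro rfl
        exact ⟨hp, sub_self _⟩
    rw [h0, Finset.card_singleton] at h2
    rw [h0, Finset.sum_singleton, sub_self, sign_zero, SignType.coe_zero, add_zero] at hsum
    omega

/-- The steepest edge at `p` leads to the right iff `p` is in the left half. -/
theorem inLeftHalf_iff_of_firstEdge_top (hEven : Even S.card) (hGen : GeneralPosition S)
    (hu : IsOrientation S u) (h : FirstEdge S u p ⊤ q) :
    InLeftHalf S u p ↔ xCoord u p < xCoord u q := by
  obtain ⟨m, hm, hlt⟩ := ((eventually_balance_neg_iff hEven hGen hu h.1.1).and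
    (eventually_gt_atTop (slope u p q))).exists
  have := sign_balance_above hEven hGen hu.1 h.1 (hu.2 _ _ h.1) Set.ordConnected_Ioi
    self_mem_nhdsWithin (fun r hr hr' => (h.2.2 r hr (WithTop.coe_lt_top _)).not_gt hr') hlt
  rw [← hm, ← sign_eq_neg_one_iff, this, sign_eq_neg_one_iff, sub_neg]

theorem rightmost_eq_right (h : xCoord u p < xCoord u q) : rightmost u p q = q := if_pos h

/-- The construction of a chain proceeds to the right. -/
theorem x_lt_of_chainState (hEven : Even S.card) (hGen : GeneralPosition S)
    (hu : IsOrientation S u) {p₀ : Plane} (h₀ : InLeftHalf S u p₀) {M : WithTop ℝ}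
    (h : ChainState S u p₀ p M) (hq : FirstEdge S u p M q) : xCoord u p < xCoord u q := by
  induction h generalizing q with
  | start => exact (inLeftHalf_iff_of_firstEdge_top hEven hGen hu hq).1 h₀
  | @step p' M' q' h' hq' ih =>
    have hx := ih hq'
    rw [rightmost_eq_right hx, slope_comm] at hq
    rw [rightmost_eq_right hx]
    exact (alternate hEven hGen hu hq'.1.symm hq.1 (WithTop.coe_lt_coe.1 hq.2.1)
      fun t ht hlt => hq.2.2 t ht (WithTop.coe_lt_coe.2 hlt)).1 hx

/-- Every edge is reached by the construction of some chain. -/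
theorem exists_chainState (hEven : Even S.card) (hGen : GeneralPosition S)
    (hu : IsOrientation S u) (h : (underlyingGraph S).Adj p q) (hx : xCoord u p < xCoord u q) :
    ∃ p₀ M, InLeftHalf S u p₀ ∧ ChainState S u p₀ p M ∧ FirstEdge S u p M q := by
  classical
  -- The construction is run backwards: each predecessor pivot lies farther left.
  induction hn : (S.filter fun r => xCoord u r < xCoord u p).card using Nat.strong_induction_on
    generalizing p q with
  | _ n ih =>
    by_cases hE : ∃ r, (underlyingGraph S).Adj p r ∧ slope u p q < slope u p r
    · have hne : (S.filter fun r =>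
          (underlyingGraph S).Adj p r ∧ slope u p q < slope u p r).Nonempty := by
        obtain ⟨r, hr⟩ := hE
        exact ⟨r, Finset.mem_filter.2 ⟨hr.1.2.1, hr⟩⟩
      -- The edge at `p` that is next steeper than `pq`; by alternation it comes from the left.
      obtain ⟨r, hr, hmin⟩ := Finset.exists_min_image _ (slope u p) hne
      obtain ⟨-, hr, hlt⟩ := Finset.mem_filter.1 hr
      have hmin' : ∀ t, (underlyingGraph S).Adj p t → slope u p t < slope u p r →
          slope u p t ≤ slope u p q := by
        intro t ht htr
        by_contra! hqt
        exact (hmin t (Finset.mem_filter.2 ⟨ht.2.1, ht, hqt⟩)).not_gt htr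
      have hrx := (alternate hEven hGen hu hr h hlt hmin').2 hx
      obtain ⟨p₀, M, h₀, h1, h2⟩ := ih _ (by
        rw [← hn]
        refine Finset.card_lt_card (Finset.ssubset_iff_of_subset ?_ |>.2 ⟨r, ?_, ?_⟩)
        · intro t ht
          simp only [Finset.mem_filter] at ht ⊢
          exact ⟨ht.1, ht.2.trans hrx⟩
        · simp [hr.2.1, hrx]
        · simp) hr.symm hrx rfl
      have h3 := ChainState.step h1 h2
      rw [rightmost_eq_right hrx, slope_comm] at h3
      exact ⟨p₀, _, h₀, h3, h, WithTop.coe_lt_coe.2 hlt,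
        fun t ht htr => hmin' t ht (WithTop.coe_lt_coe.1 htr)⟩
    · push Not at hE
      have hf : FirstEdge S u p ⊤ q := ⟨h, WithTop.coe_lt_top _, fun r hr _ => hE r hr⟩
      exact ⟨p, ⊤, (inLeftHalf_iff_of_firstEdge_top hEven hGen hu hf).2 hx, .start, hf⟩

end HalvingLines

/-! ### Chains are concave and are determined by any of their edges. -/

namespace HalvingLines

variable {S : Finset Plane} {u p q r : Plane} {m : ℝ}

theorem firstEdge_unique (hGen : GeneralPosition S) (hu : IsOrientation S u) {M : WithTop ℝ}
    (hq : FirstEdge S u p M q) (hr : FirstEdge S u p M r) : q = r :=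
  eq_of_slope_eq hGen hu.1 hq.1.1 hq.1.2.1 hr.1.2.1 (hu.2 _ _ hq.1) (hu.2 _ _ hr.1)
    ((hr.2.2 q hq.1 hq.2.1).antisymm (hq.2.2 r hr.1 hr.2.1))

/-- One step of the chain construction, as a relation between states. -/
def ChainStep (S : Finset Plane) (u : Plane) (s t : Plane × WithTop ℝ) : Prop :=
  FirstEdge S u s.1 s.2 t.1 ∧ xCoord u s.1 < xCoord u t.1 ∧ t.2 = (slope u s.1 t.1 : WithTop ℝ)

/-- Determinism makes any two states of one chain comparable: one is reached from the other. -/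
theorem chainStep_rightUnique (hGen : GeneralPosition S) (hu : IsOrientation S u) :
    Relator.RightUnique (ChainStep S u) := by
  rintro ⟨p, M⟩ ⟨q, M₁⟩ ⟨r, M₂⟩ ⟨h1, -, h2⟩ ⟨h3, -, h4⟩
  obtain rfl : q = r := firstEdge_unique hGen hu h1 h3
  exact Prod.ext rfl (h2.trans h4.symm)

theorem reflTransGen_of_chainState (hEven : Even S.card) (hGen : GeneralPosition S)
    (hu : IsOrientation S u) {p₀ : Plane} (h₀ : InLeftHalf S u p₀) {M : WithTop ℝ}
    (h : ChainState S u p₀ p M) : Relation.ReflTransGen (ChainStep S u) (p₀, ⊤) (p, M) := by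
  induction h with
  | start => exact .refl
  | step h' hq ih =>
    have hx := x_lt_of_chainState hEven hGen hu h₀ h' hq
    rw [rightmost_eq_right hx]
    exact ih.tail ⟨hq, hx, rfl⟩

/-- The part of a chain after a state lies below the line of that state, and the lines of the later
states pass above its pivot. -/
theorem below_of_reflTransGen {s : Plane × WithTop ℝ}
    (h : Relation.ReflTransGen (ChainStep S u) (q, (m : WithTop ℝ)) s) :
    ∃ m' : ℝ, s.2 = m' ∧ m' ≤ m ∧ xCoord u q ≤ xCoord u s.1 ∧
      yCoord u s.1 ≤ yCoord u q + m * (xCoord u s.1 - xCoord u q) ∧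
      yCoord u q ≤ yCoord u s.1 + m' * (xCoord u q - xCoord u s.1) := by
  induction h with
  | refl => exact ⟨m, rfl, le_rfl, le_rfl, by simp, by simp⟩
  | @tail s t _ hst ih =>
    obtain ⟨m', hm', hle, hx, h1, h2⟩ := ih
    obtain ⟨hf, hlt, ht⟩ := hst
    have hs := slope_mul hlt.ne
    have hm'' : slope u s.1 t.1 < m' := by
      have := hf.2.1
      rw [hm'] at this
      exact WithTop.coe_lt_coe.1 this
    refine ⟨_, ht, (hm''.trans_le hle).le, hx.trans hlt.le, ?_, ?_⟩
    · nlinarith [mul_nonneg (sub_nonneg.2 (hm''.trans_le hle).le) (sub_nonneg.2 hlt.le)]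
    · nlinarith [mul_nonneg (sub_nonneg.2 hm''.le) (sub_nonneg.2 hx)]

/-- The edge `pq` supports both ends of the edge `p'q'`, which does not end strictly over `pq`. -/
def Supports (u p q p' q' : Plane) : Prop :=
  ∀ z, z = p' ∨ z = q' →
    yCoord u z ≤ yCoord u p + slope u p q * (xCoord u z - xCoord u p) ∧
      (xCoord u z ≤ xCoord u p ∨ xCoord u q ≤ xCoord u z)

/-- Slopes decrease while the pivot moves right, so by concavity an earlier and a later edge each
lie below the line of the other. -/
theorem supports_of_reflTransGen (hx : xCoord u p < xCoord u q) {p' q' : Plane}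
    (hx' : xCoord u p' < xCoord u q') {M : WithTop ℝ}
    (h : Relation.ReflTransGen (ChainStep S u) (q, (slope u p q : WithTop ℝ)) (p', M))
    (hf : FirstEdge S u p' M q') : Supports u p q p' q' ∧ Supports u p' q' p q := by
  obtain ⟨m', hm', hle, hle', h1, h2⟩ := below_of_reflTransGen h
  have hlt : slope u p' q' < m' := by
    have := hf.2.1
    dsimp only at hm'
    rw [hm'] at this
    exact WithTop.coe_lt_coe.1 this
  dsimp only at hle' h1 h2
  have hs := slope_mul hx.ne
  have hs' := slope_mul hx'.ne
  constructor
  · rintro z (rfl | rfl)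
    · exact ⟨by nlinarith, Or.inr hle'⟩
    · exact ⟨by nlinarith [mul_nonneg (sub_nonneg.2 (hlt.le.trans hle)) (sub_nonneg.2 hx'.le)],
        Or.inr (hle'.trans hx'.le)⟩
  · rintro z (rfl | rfl)
    · exact ⟨by nlinarith [mul_nonneg (sub_nonneg.2 hlt.le) (sub_nonneg.2 hle'),
        mul_nonneg (sub_nonneg.2 (hlt.le.trans hle)) (sub_nonneg.2 hx.le)],
        Or.inl (hx.le.trans hle')⟩
    · exact ⟨by nlinarith [mul_nonneg (sub_nonneg.2 hlt.le) (sub_nonneg.2 hle')], Or.inl hle'⟩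

theorem supports_self (hx : xCoord u p < xCoord u q) : Supports u p q p q := by
  have hs := slope_mul hx.ne
  rintro z (rfl | rfl)
  · exact ⟨by simp, Or.inl le_rfl⟩
  · exact ⟨by linarith, Or.inr le_rfl⟩

theorem exists_state_of_mem_chainEdges (hEven : Even S.card) (hGen : GeneralPosition S)
    (hu : IsOrientation S u) {p₀ : Plane} (h₀ : InLeftHalf S u p₀) {e : Sym2 Plane}
    (he : e ∈ chainEdges S u p₀) :
    ∃ p M q, ChainState S u p₀ p M ∧ FirstEdge S u p M q ∧ e = s(p, q) ∧
      xCoord u p < xCoord u q := by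
  obtain ⟨p, M, q, h1, h2, h3⟩ := he
  exact ⟨p, M, q, h1, h2, h3, x_lt_of_chainState hEven hGen hu h₀ h1 h2⟩

theorem supports_of_mem_chainEdges (hEven : Even S.card) (hGen : GeneralPosition S)
    (hu : IsOrientation S u) {p₀ : Plane} (h₀ : InLeftHalf S u p₀) {p' q' : Plane}
    {M M' : WithTop ℝ} (h : ChainState S u p₀ p M) (hf : FirstEdge S u p M q)
    (h' : ChainState S u p₀ p' M') (hf' : FirstEdge S u p' M' q') : Supports u p q p' q' := by
  have hx := x_lt_of_chainState hEven hGen hu h₀ h hf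
  have hx' := x_lt_of_chainState hEven hGen hu h₀ h' hf'
  have hs : ChainStep S u (p, M) (q, slope u p q) := ⟨hf, hx, rfl⟩
  have hs' : ChainStep S u (p', M') (q', slope u p' q') := ⟨hf', hx', rfl⟩
  have hU := chainStep_rightUnique (S := S) hGen hu
  rcases Relation.ReflTransGen.total_of_right_unique hU
    (reflTransGen_of_chainState hEven hGen hu h₀ h)
    (reflTransGen_of_chainState hEven hGen hu h₀ h') with hr | hr
  · rcases hr.cases_head with heq | ⟨t, ht, hr⟩
    · obtain ⟨rfl, rfl⟩ := Prod.ext_iff.1 heq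
      obtain rfl : q = q' := firstEdge_unique hGen hu hf hf'
      exact supports_self hx
    · rw [hU ht hs] at hr
      exact (supports_of_reflTransGen hx hx' hr hf').1
  · rcases hr.cases_head with heq | ⟨t, ht, hr⟩
    · obtain ⟨rfl, rfl⟩ := Prod.ext_iff.1 heq
      obtain rfl : q = q' := firstEdge_unique hGen hu hf hf'
      exact supports_self hx
    · rw [hU ht hs'] at hr
      exact (supports_of_reflTransGen hx' hx hr hf).2

theorem chainState_cases (hEven : Even S.card) (hGen : GeneralPosition S)
    (hu : IsOrientation S u) {p₀ : Plane} (h₀ : InLeftHalf S u p₀) {M : WithTop ℝ}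
    (h : ChainState S u p₀ p M) : (p = p₀ ∧ M = ⊤) ∨
      ∃ p' M', ChainState S u p₀ p' M' ∧ FirstEdge S u p' M' p ∧ M = (slope u p p' : WithTop ℝ) := by
  cases h with
  | start => exact Or.inl ⟨rfl, rfl⟩
  | @step p' M' q h hq =>
    rw [rightmost_eq_right (x_lt_of_chainState hEven hGen hu h₀ h hq)]
    exact Or.inr ⟨p', M', h, hq, by rw [slope_comm]⟩

/-- Chains are determined by any of their edges. -/
theorem chainState_start_unique (hEven : Even S.card) (hGen : GeneralPosition S)
    (hu : IsOrientation S u) {p₀ p₁ : Plane} (h₀ : InLeftHalf S u p₀) (h₁ : InLeftHalf S u p₁)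
    {M M' : WithTop ℝ} (h : ChainState S u p₀ p M) (hf : FirstEdge S u p M q)
    (h' : ChainState S u p₁ p M') (hf' : FirstEdge S u p M' q) : p₀ = p₁ := by
  induction h generalizing q M' with
  | start =>
    -- A chain that starts at `p` takes the steepest edge there, but a chain arriving at `p` has
    -- arrived along a steeper edge than the one it takes next.
    rcases chainState_cases hEven hGen hu h₁ h' with ⟨h2, -⟩ | ⟨r, N, -, h3, rfl⟩
    · exact h2
    · exact absurd (WithTop.coe_lt_coe.1 hf'.2.1)
        (hf.2.2 r h3.1.symm (WithTop.coe_lt_top _)).not_gt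
  | @step p' N p hs hp ih =>
    have hx := x_lt_of_chainState hEven hGen hu h₀ hs hp
    rw [rightmost_eq_right hx] at hf h' hf'
    rw [slope_comm] at hf
    rcases chainState_cases hEven hGen hu h₁ h' with ⟨-, rfl⟩ | ⟨r, N', h2, h3, rfl⟩
    · exact absurd (WithTop.coe_lt_coe.1 hf.2.1)
        (hf'.2.2 p' hp.1.symm (WithTop.coe_lt_top _)).not_gt
    · have heq : slope u p p' = slope u p r := by
        rcases lt_trichotomy (slope u p p') (slope u p r) with hlt | heq | hlt
        · exact absurd (WithTop.coe_lt_coe.1 hf.2.1)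
            (hf'.2.2 p' hp.1.symm (WithTop.coe_lt_coe.2 hlt)).not_gt
        · exact heq
        · exact absurd (WithTop.coe_lt_coe.1 hf'.2.1)
            (hf.2.2 r h3.1.symm (WithTop.coe_lt_coe.2 hlt)).not_gt
      obtain rfl := eq_of_slope_eq hGen hu.1 hp.1.2.1 hp.1.1 h3.1.1 hx.ne' (hu.2 _ _ h3.1.symm) heq
      exact ih hp h2 h3

theorem isChain_unique (hEven : Even S.card) (hGen : GeneralPosition S) (hu : IsOrientation S u)
    {c₁ c₂ : Set (Sym2 Plane)} (h₁ : IsChain S u c₁) (h₂ : IsChain S u c₂) {e : Sym2 Plane}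
    (he₁ : e ∈ c₁) (he₂ : e ∈ c₂) : c₁ = c₂ := by
  obtain ⟨p₁, hp₁, rfl⟩ := h₁
  obtain ⟨p₂, hp₂, rfl⟩ := h₂
  obtain ⟨p, M, q, hs, hf, rfl, hx⟩ := exists_state_of_mem_chainEdges hEven hGen hu hp₁ he₁
  obtain ⟨p', M', q', hs', hf', heq, hx'⟩ := exists_state_of_mem_chainEdges hEven hGen hu hp₂ he₂
  rcases Sym2.eq_iff.1 heq with ⟨rfl, rfl⟩ | ⟨rfl, rfl⟩
  · rw [chainState_start_unique hEven hGen hu hp₁ hp₂ hs hf hs' hf']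
  · exact absurd hx hx'.not_gt

theorem exists_isChain (hEven : Even S.card) (hGen : GeneralPosition S) (hu : IsOrientation S u)
    (h : (underlyingGraph S).Adj p q) : ∃ c, IsChain S u c ∧ s(p, q) ∈ c := by
  wlog hx : xCoord u p < xCoord u q generalizing p q
  · rw [Sym2.eq_swap]
    exact this h.symm ((hu.2 _ _ h).lt_or_gt.resolve_left hx)
  obtain ⟨p₀, M, h₀, h1, h2⟩ := exists_chainState hEven hGen hu h hx
  exact ⟨_, ⟨p₀, h₀, rfl⟩, p, M, q, h1, h2, rfl⟩

theorem mem_of_mem_chainVertices {c : Set (Sym2 Plane)} (hc : IsChain S u c)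
    (hz : r ∈ chainVertices c) : r ∈ S := by
  obtain ⟨p₀, -, rfl⟩ := hc
  obtain ⟨e, ⟨p, M, q, -, hf, rfl⟩, hr⟩ := hz
  rcases Sym2.mem_iff.1 hr with rfl | rfl
  exacts [hf.1.1, hf.1.2.1]

theorem exists_openSegment_coords {a b C : Plane} (hC : C ∈ openSegment ℝ a b) (u : Plane) :
    ∃ s t : ℝ, 0 < s ∧ 0 < t ∧ s + t = 1 ∧ xCoord u C = s * xCoord u a + t * xCoord u b ∧
      ∀ p m, excess u p m C = s * excess u p m a + t * excess u p m b := by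
  obtain ⟨s, t, hs, ht, hst, rfl⟩ := hC
  refine ⟨s, t, hs, ht, hst, ?_, fun p m => ?_⟩
  · simp only [xCoord, PiLp.add_apply, PiLp.smul_apply, smul_eq_mul]
    ring
  · obtain rfl : s = 1 - t := by linarith
    simp only [excess, xCoord, yCoord, PiLp.add_apply, PiLp.smul_apply, smul_eq_mul]
    ring

theorem x_mem_Ioo_of_mem_openSegment {a b C : Plane} (hC : C ∈ openSegment ℝ a b)
    (hx : xCoord u a < xCoord u b) : xCoord u C ∈ Set.Ioo (xCoord u a) (xCoord u b) := by
  obtain ⟨s, t, hs, ht, hst, hxC, -⟩ := exists_openSegment_coords hC u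
  obtain rfl : s = 1 - t := by linarith
  constructor <;> nlinarith [mul_pos hs (sub_pos.2 hx), mul_pos ht (sub_pos.2 hx)]

/-- A chain lies below the line of each of its edges and has no vertex strictly over an edge. -/
theorem isChain_supports (hEven : Even S.card) (hGen : GeneralPosition S) (hu : IsOrientation S u)
    {c : Set (Sym2 Plane)} (hc : IsChain S u c) (he : s(p, q) ∈ c) (hr : r ∈ chainVertices c) :
    excess u p (slope u p q) r ≤ 0 ∧ ∀ C ∈ openSegment ℝ p q, xCoord u r ≠ xCoord u C := by
  obtain ⟨p₀, h₀, rfl⟩ := hc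
  obtain ⟨p', M, q', hs, hf, heq, hx⟩ := exists_state_of_mem_chainEdges hEven hGen hu h₀ he
  obtain ⟨e, ⟨p₁, M₁, q₁, hs₁, hf₁, rfl⟩, hr⟩ := hr
  obtain ⟨h1, h2⟩ := supports_of_mem_chainEdges hEven hGen hu h₀ hs hf hs₁ hf₁ r
    (Sym2.mem_iff.1 hr)
  have hsl := slope_mul hx.ne
  have h3 : ∀ C ∈ openSegment ℝ p' q', xCoord u r ≠ xCoord u C := by
    intro C hC
    obtain ⟨h3, h4⟩ := x_mem_Ioo_of_mem_openSegment hC hx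
    rcases h2 with h2 | h2
    · exact (h2.trans_lt h3).ne
    · exact (h4.trans_le h2).ne'
  rcases Sym2.eq_iff.1 heq with ⟨rfl, rfl⟩ | ⟨rfl, rfl⟩
  · exact ⟨by rw [excess]; linarith, h3⟩
  · rw [openSegment_symm, slope_comm]
    exact ⟨by rw [excess]; linarith, h3⟩

end HalvingLines

/-! ### Common upper tangents: existence, uniqueness and slope of the charged pair. -/

namespace HalvingLines

variable {S : Finset Plane} {u a b c d A B C z : Plane}

theorem excess_eq_add (u p C z : Plane) (m : ℝ) (hx : xCoord u z = xCoord u C) :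
    excess u p m z = excess u p m C + (yCoord u z - yCoord u C) := by
  rw [excess, excess, hx]
  ring

theorem excess_right (hx : xCoord u A ≠ xCoord u B) : excess u A (slope u A B) B = 0 :=
  (excess_eq_zero_iff hx).2 rfl

theorem sym2_eq_of_mem_pair {α : Type*} {a b x y : α} (hab : a ≠ b) (ha : a = x ∨ a = y)
    (hb : b = x ∨ b = y) : s(a, b) = s(x, y) := by
  rw [Sym2.eq_iff]
  rcases ha with rfl | rfl <;> rcases hb with rfl | rfl
  · exact absurd rfl hab
  · exact Or.inl ⟨rfl, rfl⟩
  · exact Or.inr ⟨rfl, rfl⟩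
  · exact absurd rfl hab

theorem mem_pair_of_excess_eq_zero (hGen : GeneralPosition S) (hu : u ≠ 0) (hA : A ∈ S)
    (hB : B ∈ S) (hx : xCoord u A ≠ xCoord u B) (hz : z ∈ S)
    (h : excess u A (slope u A B) z = 0) : z = A ∨ z = B := by
  by_contra! hne
  exact excess_ne_zero hGen hu hA hB hz hx hne.1 hne.2 h

/-- A segment with ends weakly below the line `AB` and an interior point on or above this line is
the segment `AB`. -/
theorem sym2_eq_of_excess_nonneg (hGen : GeneralPosition S) (hu : u ≠ 0) (hA : A ∈ S)
    (hB : B ∈ S) (hx : xCoord u A ≠ xCoord u B) (ha : a ∈ S) (hb : b ∈ S) (hab : a ≠ b)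
    (ha' : excess u A (slope u A B) a ≤ 0) (hb' : excess u A (slope u A B) b ≤ 0)
    (hC : C ∈ openSegment ℝ a b) (h : 0 ≤ excess u A (slope u A B) C) :
    s(a, b) = s(A, B) := by
  obtain ⟨s, t, hs, ht, -, -, hE⟩ := exists_openSegment_coords hC u
  rw [hE] at h
  have h1 := mul_nonpos_of_nonneg_of_nonpos hs.le ha'
  have h2 := mul_nonpos_of_nonneg_of_nonpos ht.le hb'
  have h3 : s * excess u A (slope u A B) a = 0 := by linarith
  have h4 : t * excess u A (slope u A B) b = 0 := by linarith
  exact sym2_eq_of_mem_pair hab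
    (mem_pair_of_excess_eq_zero hGen hu hA hB hx ha ((mul_eq_zero.1 h3).resolve_left hs.ne'))
    (mem_pair_of_excess_eq_zero hGen hu hA hB hx hb ((mul_eq_zero.1 h4).resolve_left ht.ne'))

/-- If `C` were on or above the line, both edges would be the segment `AB`, against their being
distinct. -/
theorem crossing_below (hGen : GeneralPosition S) (hu : u ≠ 0) (hC : IsCrossing S a b c d C)
    (hA : A ∈ S) (hB : B ∈ S) (hx : xCoord u A ≠ xCoord u B)
    (ha : excess u A (slope u A B) a ≤ 0) (hb : excess u A (slope u A B) b ≤ 0)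
    (hc : excess u A (slope u A B) c ≤ 0) (hd : excess u A (slope u A B) d ≤ 0) :
    excess u A (slope u A B) C < 0 := by
  obtain ⟨hab, hcd, hne, h1, h2⟩ := hC
  by_contra! h
  exact hne ((sym2_eq_of_excess_nonneg hGen hu hA hB hx hab.1 hab.2.1 hab.ne ha hb h1 h).trans
    (sym2_eq_of_excess_nonneg hGen hu hA hB hx hcd.1 hcd.2.1 hcd.ne hc hd h2 h).symm)

/-- The upper hull of a finite set in general position over a vertical line that avoids it. -/
theorem exists_upper_tangent (hGen : GeneralPosition S) (hu : u ≠ 0) {V : Set Plane}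
    (hV : V ⊆ S) {x₀ : ℝ} (hx₀ : ∀ z ∈ V, xCoord u z ≠ x₀) (hA : ∃ z ∈ V, xCoord u z < x₀)
    (hB : ∃ z ∈ V, x₀ < xCoord u z) :
    ∃ A ∈ V, ∃ B ∈ V, xCoord u A < x₀ ∧ x₀ < xCoord u B ∧
      ∀ z ∈ V, z ≠ A → z ≠ B → excess u A (slope u A B) z < 0 := by
  classical
  have hVf : V.Finite := S.finite_toSet.subset hV
  have hne : ((hVf.toFinset.filter fun z => xCoord u z < x₀) ×ˢ
      (hVf.toFinset.filter fun z => x₀ < xCoord u z)).Nonempty := by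
    obtain ⟨A, hA⟩ := hA
    obtain ⟨B, hB⟩ := hB
    exact ⟨(A, B), by simp [hA, hB]⟩
  -- Among all pairs separated by the vertical line at `x₀`, take one whose line is highest there.
  obtain ⟨⟨A, B⟩, hAB, hmax⟩ := Finset.exists_max_image _
    (fun P => yCoord u P.1 + slope u P.1 P.2 * (x₀ - xCoord u P.1)) hne
  simp only [Finset.mem_product, Finset.mem_filter, Set.Finite.mem_toFinset] at hAB
  obtain ⟨⟨hA, hAx⟩, hB, hBx⟩ := hAB
  refine ⟨A, hA, B, hB, hAx, hBx, fun z hz hzA hzB => ?_⟩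
  have hx := (hAx.trans hBx).ne
  by_contra! h
  have hpos := h.lt_of_ne (excess_ne_zero hGen hu (hV hA) (hV hB) (hV hz) hx hzA hzB).symm
  have hAB := slope_mul hx
  rw [excess] at hpos
  rcases (hx₀ z hz).lt_or_gt with hzx | hzx
  -- A point `z` above `AB` could replace the end on its own side of `x₀` and raise the line over
  -- `x₀`.
  · have := hmax (z, B) (by simp [hz, hB, hzx, hBx])
    dsimp only at this
    have hzB := slope_mul (hzx.trans hBx).ne
    have hδ : 0 < xCoord u B - xCoord u z := sub_pos.2 (hzx.trans hBx)
    have key : (yCoord u z + slope u z B * (x₀ - xCoord u z) -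
        (yCoord u A + slope u A B * (x₀ - xCoord u A))) * (xCoord u B - xCoord u z) =
        (yCoord u z - yCoord u A - slope u A B * (xCoord u z - xCoord u A)) *
          (xCoord u B - x₀) := by
      linear_combination (x₀ - xCoord u z) * hzB - (x₀ - xCoord u z) * hAB
    have h1 := mul_pos hpos (sub_pos.2 hBx)
    rw [← key] at h1
    linarith [(mul_pos_iff_of_pos_right hδ).1 h1]
  · have := hmax (A, z) (by simp [hz, hA, hzx, hAx])
    dsimp only at this
    have hAz := slope_mul (hAx.trans hzx).ne
    rw [← hAz, ← sub_mul] at hpos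
    have h1 := (mul_pos_iff_of_pos_right (sub_pos.2 (hAx.trans hzx))).1 hpos
    nlinarith [mul_pos h1 (sub_pos.2 hAx)]

theorem strictlyBelow_iff_excess_neg : StrictlyBelow u A B z ↔ excess u A (slope u A B) z < 0 := by
  rw [StrictlyBelow, excess]
  constructor <;> intro h <;> linarith

theorem exists_mem_openSegment_x {x₀ : ℝ} (h₁ : xCoord u A < x₀) (h₂ : x₀ < xCoord u B) :
    ∃ z ∈ openSegment ℝ A B, xCoord u z = x₀ := by
  have h : x₀ ∈ openSegment ℝ (xCoord u A) (xCoord u B) := by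
    rw [openSegment_eq_Ioo (h₁.trans h₂)]
    exact ⟨h₁, h₂⟩
  obtain ⟨s, t, hs, ht, hst, h⟩ := h
  refine ⟨_, ⟨s, t, hs, ht, hst, rfl⟩, ?_⟩
  rw [← h]
  simp only [xCoord, PiLp.add_apply, PiLp.smul_apply, smul_eq_mul]
  ring

theorem excess_eq_zero_of_mem_openSegment (hx : xCoord u A ≠ xCoord u B)
    (hz : z ∈ openSegment ℝ A B) : excess u A (slope u A B) z = 0 := by
  obtain ⟨s, t, -, -, -, -, hE⟩ := exists_openSegment_coords hz u
  rw [hE, excess_self, excess_right hx]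
  ring

theorem excess_nonpos_of_mem_openSegment {p : Plane} {m : ℝ} (hz : z ∈ openSegment ℝ A B)
    (hA : excess u p m A ≤ 0) (hB : excess u p m B ≤ 0) : excess u p m z ≤ 0 := by
  obtain ⟨s, t, hs, ht, -, -, hE⟩ := exists_openSegment_coords hz u
  rw [hE]
  exact add_nonpos (mul_nonpos_of_nonneg_of_nonpos hs.le hA)
    (mul_nonpos_of_nonneg_of_nonpos ht.le hB)

/-- If both ends of an upper tangent over the crossing were on one chain, then this tangent would
pass below the crossing. -/
theorem not_both_ends_of_below (hab : xCoord u a ≠ xCoord u b) (hC : C ∈ openSegment ℝ a b)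
    (hA : excess u a (slope u a b) A ≤ 0) (hB : excess u a (slope u a b) B ≤ 0)
    (hx₁ : xCoord u A < xCoord u C) (hx₂ : xCoord u C < xCoord u B) :
    0 ≤ excess u A (slope u A B) C := by
  obtain ⟨z, hz, hzx⟩ := exists_mem_openSegment_x hx₁ hx₂
  have h1 := excess_eq_zero_of_mem_openSegment (hx₁.trans hx₂).ne hz
  have h2 := excess_nonpos_of_mem_openSegment hz hA hB
  have h3 := excess_eq_zero_of_mem_openSegment hab hC
  rw [excess_eq_add u _ C z _ hzx] at h1 h2
  linarith

theorem excess_nonpos_of_tangent {c₁ c₂ : Set (Sym2 Plane)} (h : IsCommonUpperTangent u c₁ c₂ A B)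
    (hz : z ∈ chainVertices c₁ ∪ chainVertices c₂) : excess u A (slope u A B) z ≤ 0 := by
  by_cases hA : z = A
  · rw [hA, excess_self]
  by_cases hB : z = B
  · rw [hB, excess_right h.2.2.1]
  exact (strictlyBelow_iff_excess_neg.1 (h.2.2.2 z hz hA hB)).le

theorem isCommonUpperTangent_symm {c₁ c₂ : Set (Sym2 Plane)}
    (h : IsCommonUpperTangent u c₁ c₂ A B) : IsCommonUpperTangent u c₂ c₁ B A := by
  refine ⟨h.2.1, h.1, h.2.2.1.symm, fun z hz hB hA => ?_⟩
  have h1 := h.2.2.2 z (Set.union_comm _ _ ▸ hz) hA hB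
  have h2 := slope_mul h.2.2.1
  rw [StrictlyBelow] at h1 ⊢
  rw [slope_comm u B A]
  linarith

theorem exists_isCharged (hEven : Even S.card) (hGen : GeneralPosition S) (hu : IsOrientation S u)
    (hC : IsCrossing S a b c d C) : ∃ P, IsCharged S u s(a, b) s(c, d) C P := by
  obtain ⟨hab, hcd, -, hCab, hCcd⟩ := id hC
  obtain ⟨c₁, hc₁, h₁⟩ := exists_isChain hEven hGen hu hab
  obtain ⟨c₂, hc₂, h₂⟩ := exists_isChain hEven hGen hu hcd
  have ha : a ∈ chainVertices c₁ := ⟨_, h₁, by simp⟩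
  have hb : b ∈ chainVertices c₁ := ⟨_, h₁, by simp⟩
  have hc : c ∈ chainVertices c₂ := ⟨_, h₂, by simp⟩
  have hd : d ∈ chainVertices c₂ := ⟨_, h₂, by simp⟩
  have hV : chainVertices c₁ ∪ chainVertices c₂ ⊆ S := by
    rintro z (hz | hz)
    exacts [mem_of_mem_chainVertices hc₁ hz, mem_of_mem_chainVertices hc₂ hz]
  have hx₀ : ∀ z ∈ chainVertices c₁ ∪ chainVertices c₂, xCoord u z ≠ xCoord u C := by
    rintro z (hz | hz)
    exacts [(isChain_supports hEven hGen hu hc₁ h₁ hz).2 C hCab,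
      (isChain_supports hEven hGen hu hc₂ h₂ hz).2 C hCcd]
  have hsides : (∃ z ∈ chainVertices c₁ ∪ chainVertices c₂, xCoord u z < xCoord u C) ∧
      ∃ z ∈ chainVertices c₁ ∪ chainVertices c₂, xCoord u C < xCoord u z := by
    rcases (hu.2 _ _ hab).lt_or_gt with h | h
    · obtain ⟨h3, h4⟩ := x_mem_Ioo_of_mem_openSegment hCab h
      exact ⟨⟨a, Or.inl ha, h3⟩, ⟨b, Or.inl hb, h4⟩⟩
    · obtain ⟨h3, h4⟩ := x_mem_Ioo_of_mem_openSegment (openSegment_symm ℝ a b ▸ hCab) h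
      exact ⟨⟨b, Or.inl hb, h3⟩, ⟨a, Or.inl ha, h4⟩⟩
  obtain ⟨A, hA, B, hB, hxA, hxB, hbelow⟩ :=
    exists_upper_tangent hGen hu.1 hV hx₀ hsides.1 hsides.2
  have hx := (hxA.trans hxB).ne
  have hle : ∀ z ∈ chainVertices c₁ ∪ chainVertices c₂, excess u A (slope u A B) z ≤ 0 := by
    intro z hz
    by_cases hzA : z = A
    · rw [hzA, excess_self]
    by_cases hzB : z = B
    · rw [hzB, excess_right hx]
    exact (hbelow z hz hzA hzB).le
  have hlt := crossing_below hGen hu.1 hC (hV hA) (hV hB) hx (hle a (Or.inl ha))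
    (hle b (Or.inl hb)) (hle c (Or.inr hc)) (hle d (Or.inr hd))
  -- A segment with both ends below line `ab` cannot pass strictly above `C`, which is on that line.
  have hn₁ : ¬ (A ∈ chainVertices c₁ ∧ B ∈ chainVertices c₁) := fun h =>
    (not_both_ends_of_below (hu.2 _ _ hab) hCab (isChain_supports hEven hGen hu hc₁ h₁ h.1).1
      (isChain_supports hEven hGen hu hc₁ h₁ h.2).1 hxA hxB).not_gt hlt
  have hn₂ : ¬ (A ∈ chainVertices c₂ ∧ B ∈ chainVertices c₂) := fun h =>
    (not_both_ends_of_below (hu.2 _ _ hcd) hCcd (isChain_supports hEven hGen hu hc₂ h₂ h.1).1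
      (isChain_supports hEven hGen hu hc₂ h₂ h.2).1 hxA hxB).not_gt hlt
  obtain ⟨z, hz, hzx⟩ := exists_mem_openSegment_x hxA hxB
  have hz' := openSegment_subset_segment ℝ A B hz
  rcases hA with hA | hA
  · refine ⟨s(A, B), c₁, c₂, hc₁, hc₂, h₁, h₂, A, B, rfl, ⟨hA, ?_, hx, ?_⟩, z, hz', hzx⟩
    · exact hB.resolve_left fun h => hn₁ ⟨hA, h⟩
    · exact fun z hz hzA hzB => strictlyBelow_iff_excess_neg.2 (hbelow z hz hzA hzB)
  · have hB' := hB.resolve_right fun h => hn₂ ⟨hA, h⟩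
    refine ⟨s(A, B), c₁, c₂, hc₁, hc₂, h₁, h₂, B, A, Sym2.eq_swap,
      isCommonUpperTangent_symm ⟨hA, hB', hx, ?_⟩, z, segment_symm ℝ A B ▸ hz', hzx⟩
    exact fun z hz hzA hzB => strictlyBelow_iff_excess_neg.2
      (hbelow z (Set.union_comm _ _ ▸ hz) hzA hzB)

theorem mem_openSegment_of_x_ne (hz : z ∈ segment ℝ A B) (hA : xCoord u A ≠ xCoord u z)
    (hB : xCoord u B ≠ xCoord u z) : z ∈ openSegment ℝ A B :=
  mem_openSegment_of_ne_left_right (by rintro rfl; exact hA rfl) (by rintro rfl; exact hB rfl) hz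

/-- Each tangent has its ends weakly below the other, so over `C` they have the same height, and a
segment touching a line from below at an interior point lies on it. -/
theorem isCharged_unique (hEven : Even S.card) (hGen : GeneralPosition S) (hu : IsOrientation S u)
    (hC : IsCrossing S a b c d C) {P P' : Sym2 Plane} (h : IsCharged S u s(a, b) s(c, d) C P)
    (h' : IsCharged S u s(a, b) s(c, d) C P') : P = P' := by
  obtain ⟨-, -, -, hCab, hCcd⟩ := hC
  obtain ⟨c₁, c₂, hc₁, hc₂, h₁, h₂, A, B, rfl, hT, z, hz, hzx⟩ := h
  obtain ⟨c₁', c₂', hc₁', hc₂', h₁', h₂', A', B', rfl, hT', z', hz', hzx'⟩ := h'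
  obtain rfl := isChain_unique hEven hGen hu hc₁ hc₁' h₁ h₁'
  obtain rfl := isChain_unique hEven hGen hu hc₂ hc₂' h₂ h₂'
  have hx₁ : ∀ z ∈ chainVertices c₁, xCoord u z ≠ xCoord u C := fun z hz =>
    (isChain_supports hEven hGen hu hc₁ h₁ hz).2 C hCab
  have hx₂ : ∀ z ∈ chainVertices c₂, xCoord u z ≠ xCoord u C := fun z hz =>
    (isChain_supports hEven hGen hu hc₂ h₂ hz).2 C hCcd
  have hzo := mem_openSegment_of_x_ne hz (hzx ▸ hx₁ A hT.1) (hzx ▸ hx₂ B hT.2.1)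
  have hzo' := mem_openSegment_of_x_ne hz' (hzx' ▸ hx₁ A' hT'.1) (hzx' ▸ hx₂ B' hT'.2.1)
  have e1 := excess_eq_zero_of_mem_openSegment hT.2.2.1 hzo
  have e2 := excess_eq_zero_of_mem_openSegment hT'.2.2.1 hzo'
  have hA := excess_nonpos_of_tangent hT' (Or.inl hT.1)
  have hB := excess_nonpos_of_tangent hT' (Or.inr hT.2.1)
  have e3 := excess_nonpos_of_mem_openSegment hzo' (excess_nonpos_of_tangent hT (Or.inl hT'.1))
    (excess_nonpos_of_tangent hT (Or.inr hT'.2.1))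
  rw [excess_eq_add u A z z' _ (hzx'.trans hzx.symm), e1] at e3
  refine sym2_eq_of_excess_nonneg hGen hu.1 (mem_of_mem_chainVertices hc₁ hT'.1)
    (mem_of_mem_chainVertices hc₂ hT'.2.1) hT'.2.2.1 (mem_of_mem_chainVertices hc₁ hT.1)
    (mem_of_mem_chainVertices hc₂ hT.2.1) (fun h => hT.2.2.1 (h ▸ rfl)) hA hB hzo ?_
  rw [excess_eq_add u A' z' z _ (hzx.trans hzx'.symm), e2]
  linarith

/-- The product of slope differences says that the slope of `AB` is strictly between those of `ab`
and `cd`; this yields the double wedge, and the position of `C` below `AB` separates `u` from `-u`.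
-/
theorem isCharged_props (hEven : Even S.card) (hGen : GeneralPosition S) (hu : IsOrientation S u)
    (hC : IsCrossing S a b c d C) {P : Sym2 Plane} (h : IsCharged S u s(a, b) s(c, d) C P) :
    ∃ A B, P = s(A, B) ∧ xCoord u A ≠ xCoord u B ∧
      (slope u a b - slope u A B) * (slope u c d - slope u A B) < 0 ∧
      ∃ z ∈ segment ℝ A B, xCoord u z = xCoord u C ∧ yCoord u C < yCoord u z := by
  obtain ⟨hab, hcd, -, hCab, hCcd⟩ := id hC
  obtain ⟨c₁, c₂, hc₁, hc₂, h₁, h₂, A, B, rfl, hT, z, hz, hzx⟩ := h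
  obtain ⟨hA, hxA⟩ := isChain_supports hEven hGen hu hc₁ h₁ hT.1
  obtain ⟨hB, hxB⟩ := isChain_supports hEven hGen hu hc₂ h₂ hT.2.1
  have hzo := mem_openSegment_of_x_ne hz (hzx ▸ hxA C hCab) (hzx ▸ hxB C hCcd)
  have hlt := crossing_below hGen hu.1 hC (mem_of_mem_chainVertices hc₁ hT.1)
    (mem_of_mem_chainVertices hc₂ hT.2.1) hT.2.2.1
    (excess_nonpos_of_tangent hT (Or.inl ⟨_, h₁, by simp⟩))
    (excess_nonpos_of_tangent hT (Or.inl ⟨_, h₁, by simp⟩))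
    (excess_nonpos_of_tangent hT (Or.inr ⟨_, h₂, by simp⟩))
    (excess_nonpos_of_tangent hT (Or.inr ⟨_, h₂, by simp⟩))
  have e1 := excess_eq_zero_of_mem_openSegment hT.2.2.1 hzo
  have e2 := excess_eq_zero_of_mem_openSegment (hu.2 _ _ hab) hCab
  have e3 := excess_eq_zero_of_mem_openSegment (hu.2 _ _ hcd) hCcd
  have hyz := e1
  rw [excess_eq_add u A C z _ hzx] at hyz
  refine ⟨A, B, rfl, hT.2.2.1, ?_, z, hz, hzx, by linarith⟩
  have hAB := slope_mul hT.2.2.1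
  rw [excess] at hA hB hlt e2 e3
  -- Seen from `C`, which is strictly below `AB`, the point `A` is weakly below line `ab`.
  have f1 : 0 < (slope u a b - slope u A B) * (xCoord u A - xCoord u C) := by linarith
  have f2 : 0 < (slope u c d - slope u A B) * (xCoord u B - xCoord u C) := by linarith
  obtain ⟨s, t, hs, ht, hst, hx, -⟩ := exists_openSegment_coords hzo u
  -- This makes the horizontal offsets of `A` and `B` from `C` opposite in sign.
  have f3 : t * ((xCoord u A - xCoord u C) * (xCoord u B - xCoord u C)) =
      -(s * (xCoord u A - xCoord u C) ^ 2) := by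
    rw [← hzx, hx]
    obtain rfl : s = 1 - t := by linarith
    ring
  have f4 : 0 < s * (xCoord u A - xCoord u C) ^ 2 :=
    mul_pos hs (sq_pos_of_ne_zero (sub_ne_zero.2 (hxA C hCab)))
  by_contra! h
  nlinarith [mul_pos f1 f2, mul_pos (mul_pos f1 f2) ht]

end HalvingLines

/-! ### Double wedges of directions, opposite orientations and bisectors. -/

namespace HalvingLines

variable {S : Finset Plane} {u u' a b c d C : Plane}

theorem cross_neg_right (v w : Plane) : cross v (-w) = -cross v w := by
  simp only [cross, PiLp.neg_apply]
  ring

theorem cross_smul_add_smul_right (α β : ℝ) (e v w : Plane) :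
    cross e (α • v + β • w) = α * cross e v + β * cross e w := by
  simp only [cross, PiLp.add_apply, PiLp.smul_apply, smul_eq_mul]
  ring

theorem cross_self (v : Plane) : cross v v = 0 := by rw [cross, mul_comm, sub_self]

theorem cross_swap_args (v w : Plane) : cross w v = -cross v w := by
  rw [cross, cross]
  ring

theorem xCoord_sub (u p q : Plane) : xCoord u p - xCoord u q = cross (p - q) u := by
  simp only [xCoord, cross, PiLp.sub_apply]
  ring

theorem cross_sub_eq_slope {A B : Plane} (hab : xCoord u a ≠ xCoord u b)
    (hAB : xCoord u A ≠ xCoord u B) : (u 0 ^ 2 + u 1 ^ 2) * cross (b - a) (B - A) =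
      -((slope u a b - slope u A B) * (cross (b - a) u * cross (B - A) u)) := by
  rw [← xCoord_sub u, ← xCoord_sub u B]
  have h1 := slope_mul hab
  have h2 := slope_mul hAB
  have h3 : (u 0 ^ 2 + u 1 ^ 2) * cross (b - a) (B - A) =
      (xCoord u b - xCoord u a) * (yCoord u B - yCoord u A) -
        (yCoord u b - yCoord u a) * (xCoord u B - xCoord u A) := by
    simp only [xCoord, yCoord, cross, PiLp.sub_apply]
    ring
  rw [h3, ← h1, ← h2]
  ring

/-- A charged pair and the upward direction are separated by the lines of the two edges. -/
theorem isCharged_wedge (hEven : Even S.card) (hGen : GeneralPosition S) (hu : IsOrientation S u)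
    (hC : IsCrossing S a b c d C) {P : Sym2 Plane} (h : IsCharged S u s(a, b) s(c, d) C P) :
    ∃ A B, P = s(A, B) ∧ cross (b - a) (B - A) * cross (d - c) (B - A) *
      (cross (b - a) u * cross (d - c) u) < 0 := by
  obtain ⟨A, B, hP, hx, hs, -⟩ := isCharged_props hEven hGen hu hC h
  refine ⟨A, B, hP, ?_⟩
  have h1 := cross_sub_eq_slope (hu.2 _ _ hC.1) hx
  have h2 := cross_sub_eq_slope (hu.2 _ _ hC.2.1) hx
  have hN := normSq_coords_pos hu.1
  have n1 : cross (b - a) u ≠ 0 := xCoord_sub u b a ▸ sub_ne_zero.2 (hu.2 _ _ hC.1).symm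
  have n2 : cross (d - c) u ≠ 0 := xCoord_sub u d c ▸ sub_ne_zero.2 (hu.2 _ _ hC.2.1).symm
  have n3 : cross (B - A) u ≠ 0 := xCoord_sub u B A ▸ sub_ne_zero.2 hx.symm
  -- Apart from the slope differences all factors on the right form a square, so only those
  -- differences decide the sign.
  have key : (u 0 ^ 2 + u 1 ^ 2) ^ 2 * (cross (b - a) (B - A) * cross (d - c) (B - A) *
      (cross (b - a) u * cross (d - c) u)) =
      ((slope u a b - slope u A B) * (slope u c d - slope u A B)) *
        (cross (b - a) u * cross (d - c) u * cross (B - A) u) ^ 2 := by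
    linear_combination (u 0 ^ 2 + u 1 ^ 2) * cross (d - c) (B - A) *
      (cross (b - a) u * cross (d - c) u) * h1 -
      (slope u a b - slope u A B) * (cross (b - a) u * cross (B - A) u) *
      (cross (b - a) u * cross (d - c) u) * h2
  have hneg := mul_neg_of_neg_of_pos hs
    (sq_pos_of_ne_zero (mul_ne_zero (mul_ne_zero n1 n2) n3))
  rw [← key] at hneg
  exact neg_of_mul_neg_right hneg (sq_nonneg _)

/-- Orientations with the same charged pair lie in the same double wedge of the two edges. -/
theorem same_wedge_of_isCharged (hEven : Even S.card) (hGen : GeneralPosition S)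
    (hu : IsOrientation S u) (hu' : IsOrientation S u') (hC : IsCrossing S a b c d C)
    {P : Sym2 Plane} (h : IsCharged S u s(a, b) s(c, d) C P)
    (h' : IsCharged S u' s(a, b) s(c, d) C P) :
    0 < cross (b - a) u * cross (d - c) u * (cross (b - a) u' * cross (d - c) u') := by
  obtain ⟨A, B, rfl, h1⟩ := isCharged_wedge hEven hGen hu hC h
  obtain ⟨A', B', hP, h2⟩ := isCharged_wedge hEven hGen hu' hC h'
  -- Exchanging `A` and `B` flips both factors, so the double wedge depends only on the unordered
  -- pair.
  have h3 : cross (b - a) (B' - A') * cross (d - c) (B' - A') =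
      cross (b - a) (B - A) * cross (d - c) (B - A) := by
    rcases Sym2.eq_iff.1 hP with ⟨rfl, rfl⟩ | ⟨rfl, rfl⟩
    · rfl
    · rw [← neg_sub A B, cross_neg_right, cross_neg_right, neg_mul_neg]
  rw [h3] at h2
  have h4 := mul_pos_of_neg_of_neg h1 h2
  rw [mul_mul_mul_comm] at h4
  exact (pos_iff_pos_of_mul_pos h4).1 (mul_self_pos.2 (left_ne_zero_of_mul h1.ne))

theorem xCoord_neg (u p : Plane) : xCoord (-u) p = -xCoord u p := by
  simp only [xCoord, PiLp.neg_apply]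
  ring

theorem yCoord_neg (u p : Plane) : yCoord (-u) p = -yCoord u p := by
  simp only [yCoord, PiLp.neg_apply]
  ring

theorem IsOrientation.neg (hu : IsOrientation S u) : IsOrientation S (-u) :=
  ⟨neg_ne_zero.2 hu.1, fun p q h => by
    rw [xCoord_neg, xCoord_neg, ne_eq, neg_inj]
    exact hu.2 p q h⟩

theorem eq_of_mem_segment_of_x_eq {A B z z' : Plane} (hx : xCoord u A ≠ xCoord u B)
    (hz : z ∈ segment ℝ A B) (hz' : z' ∈ segment ℝ A B) (h : xCoord u z = xCoord u z') :
    z = z' := by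
  rw [segment_eq_image_lineMap] at hz hz'
  obtain ⟨s, -, rfl⟩ := hz
  obtain ⟨t, -, rfl⟩ := hz'
  have key : ∀ t : ℝ, xCoord u (AffineMap.lineMap A B t) =
      xCoord u A + t * (xCoord u B - xCoord u A) := by
    intro t
    simp only [AffineMap.lineMap_apply, vsub_eq_sub, vadd_eq_add, xCoord, PiLp.add_apply,
      PiLp.smul_apply, PiLp.sub_apply, smul_eq_mul]
    ring
  rw [key, key, add_right_inj, mul_eq_mul_right_iff, or_iff_left (sub_ne_zero.2 hx.symm)] at h
  rw [h]

/-- Opposite orientations charge different pairs: one passes above the crossing, the other below. -/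
theorem not_isCharged_neg (hEven : Even S.card) (hGen : GeneralPosition S)
    (hu : IsOrientation S u) (hC : IsCrossing S a b c d C) {P : Sym2 Plane}
    (h : IsCharged S u s(a, b) s(c, d) C P) : ¬ IsCharged S (-u) s(a, b) s(c, d) C P := by
  intro h'
  obtain ⟨A, B, rfl, hx, -, z, hz, hzx, hzy⟩ := isCharged_props hEven hGen hu hC h
  obtain ⟨A', B', hP, -, -, z', hz', hzx', hzy'⟩ := isCharged_props hEven hGen hu.neg hC h'
  have hz'' : z' ∈ segment ℝ A B := by
    rcases Sym2.eq_iff.1 hP with ⟨rfl, rfl⟩ | ⟨rfl, rfl⟩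
    · exact hz'
    · rwa [segment_symm]
  rw [xCoord_neg, xCoord_neg, neg_inj] at hzx'
  rw [yCoord_neg, yCoord_neg, neg_lt_neg_iff] at hzy'
  rw [eq_of_mem_segment_of_x_eq hx hz hz'' (hzx.trans hzx'.symm)] at hzy
  exact hzy.not_gt hzy'

/-- Parallel edges through a common point would be on one line, and general position would then make
them equal. -/
theorem IsCrossing.cross_ne_zero (hGen : GeneralPosition S) (hC : IsCrossing S a b c d C) :
    cross (b - a) (d - c) ≠ 0 := by
  obtain ⟨hab, hcd, hne, ⟨s, t, -, -, hst, h1⟩, ⟨s', t', hs', ht', hst', h2⟩⟩ := hC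
  intro h
  obtain rfl : s = 1 - t := by linarith
  obtain rfl : s' = 1 - t' := by linarith
  rw [← h2] at h1
  have h0 := congrArg (fun z : Plane => z 0) h1
  have h1 := congrArg (fun z : Plane => z 1) h1
  simp only [PiLp.add_apply, PiLp.smul_apply, smul_eq_mul] at h0 h1
  have hc : cross (b - a) (c - a) = 0 := by
    simp only [cross, PiLp.sub_apply] at h ⊢
    linear_combination (b 1 - a 1) * h0 - (b 0 - a 0) * h1 - t' * h
  have hd : cross (b - a) (d - a) = 0 := by
    simp only [cross, PiLp.sub_apply] at h hc ⊢
    linear_combination hc + h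
  have key : ∀ z ∈ S, cross (b - a) (z - a) = 0 → z = a ∨ z = b := by
    intro z hz h0
    by_contra! hz'
    exact HalvingLines.cross_ne_zero hGen hab.1 hab.2.1 hz hab.ne hz'.1.symm hz'.2.symm h0
  exact hne (sym2_eq_of_mem_pair hcd.ne (key c hcd.1 hc) (key d hcd.2.1 hd)).symm

theorem eq_of_cross_eq {v w e e' : Plane} (hvw : cross v w ≠ 0) (h1 : cross e v = cross e' v)
    (h2 : cross e w = cross e' w) : e = e' := by
  simp only [cross] at *
  have h3 : (v 0 * w 1 - v 1 * w 0) * (e 0 - e' 0) = 0 := by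
    linear_combination v 0 * h2 - w 0 * h1
  have h4 : (v 0 * w 1 - v 1 * w 0) * (e 1 - e' 1) = 0 := by
    linear_combination v 1 * h2 - w 1 * h1
  ext i
  fin_cases i
  · simpa [hvw, sub_eq_zero] using h3
  · simpa [hvw, sub_eq_zero] using h4

theorem smul_add_smul_injective {v w : Plane} (hvw : cross v w ≠ 0) :
    Function.Injective fun x : ℝ × ℝ => x.1 • v + x.2 • w := by
  rintro ⟨α, β⟩ ⟨α', β'⟩ h
  dsimp only at h
  have h1 := congrArg (cross v) h
  have h2 := congrArg (cross w) h
  simp only [cross_smul_add_smul_right, cross_self, mul_zero, zero_add, add_zero] at h1 h2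
  have hwv : cross w v ≠ 0 := by rwa [cross_swap_args, neg_ne_zero]
  rw [mul_right_cancel₀ hvw h1, mul_right_cancel₀ hwv h2]

theorem ncard_bisectors (h : cross (b - a) (d - c) ≠ 0) : (bisectors a b c d).ncard = 4 := by
  have hv : ‖b - a‖ ≠ 0 := by
    rw [norm_ne_zero_iff]
    rintro h0
    simp [h0, cross] at h
  have hw : ‖d - c‖ ≠ 0 := by
    rw [norm_ne_zero_iff]
    rintro h0
    simp [h0, cross] at h
  have heq : bisectors a b c d = (fun x : ℝ × ℝ => (x.1 / ‖b - a‖) • (b - a) +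
      (x.2 / ‖d - c‖) • (d - c)) '' (({1, -1} ×ˢ {1, -1} : Finset (ℝ × ℝ)) : Set (ℝ × ℝ)) := by
    ext u
    simp only [bisectors, Set.mem_ofPred_eq, Set.mem_image, Finset.mem_coe, Finset.mem_product,
      Finset.mem_insert, Finset.mem_singleton, Prod.exists]
    constructor
    · rintro ⟨σ, τ, h1, h2, rfl⟩
      exact ⟨σ, τ, ⟨h1, h2⟩, rfl⟩
    · rintro ⟨σ, τ, ⟨h1, h2⟩, rfl⟩
      exact ⟨σ, τ, h1, h2, rfl⟩
  have hinj : Function.Injective fun x : ℝ × ℝ => (x.1 / ‖b - a‖) • (b - a) +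
      (x.2 / ‖d - c‖) • (d - c) := by
    rintro ⟨σ, τ⟩ ⟨σ', τ'⟩ hx
    have := smul_add_smul_injective h
      (a₁ := (σ / ‖b - a‖, τ / ‖d - c‖)) (a₂ := (σ' / ‖b - a‖, τ' / ‖d - c‖)) hx
    obtain ⟨h1, h2⟩ := Prod.ext_iff.1 this
    exact Prod.ext ((div_left_inj' hv).1 h1) ((div_left_inj' hw).1 h2)
  rw [heq, Set.ncard_image_of_injective _ hinj, Set.ncard_coe_finset, Finset.card_product,
    Finset.card_pair (by norm_num)]

/-- Only finitely many multipliers `t` fail to make `v + t w` an orientation. -/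
theorem exists_isOrientation (S : Finset Plane) {v w : Plane} (hvw : cross v w ≠ 0) {T : Set ℝ}
    (hT : T.Infinite) : ∃ t ∈ T, IsOrientation S ((1 : ℝ) • v + t • w) := by
  have hfin : (⋃ p ∈ S, ⋃ q ∈ S, {t : ℝ | p ≠ q ∧
      xCoord ((1 : ℝ) • v + t • w) p = xCoord ((1 : ℝ) • v + t • w) q}).Finite := by
    refine S.finite_toSet.biUnion fun p _ => S.finite_toSet.biUnion fun q _ => ?_
    refine Set.Subsingleton.finite ?_
    -- Two bad multipliers for the same points would make `p - q` parallel to both `v` and `w`,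
    -- hence zero.
    rintro t ⟨hpq, ht⟩ t' ⟨-, ht'⟩
    rw [← sub_eq_zero, xCoord_sub, cross_smul_add_smul_right, one_mul] at ht ht'
    by_contra hne
    have h1 : (t - t') * cross (p - q) w = 0 := by linear_combination ht - ht'
    have h2 := (mul_eq_zero.1 h1).resolve_left (sub_ne_zero.2 hne)
    rw [h2, mul_zero, add_zero] at ht
    refine hpq (sub_eq_zero.1 (eq_of_cross_eq hvw ?_ ?_))
    · simpa [cross] using ht
    · simpa [cross] using h2
  obtain ⟨t, ht, ht'⟩ := (hT.sdiff hfin).nonempty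
  refine ⟨t, ht, ?_, fun p q h hx => ht' ?_⟩
  · intro h0
    have := congrArg (cross w) h0
    rw [cross_smul_add_smul_right, cross_self, cross_swap_args, one_mul, mul_zero, add_zero] at this
    exact hvw (neg_eq_zero.1 (this.trans (by simp [cross])))
  · simp only [Set.mem_iUnion]
    exact ⟨p, h.1, q, h.2.1, h.ne, hx⟩

/-- The sign of `α * β` alone decides the double wedge of `α • v + β • w` when `v` and `w` are
independent. -/
theorem wedge_smul_add_smul (α β : ℝ) (v w : Plane) :
    cross v (α • v + β • w) * cross w (α • v + β • w) = -(α * β * cross v w ^ 2) := by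
  rw [cross_smul_add_smul_right, cross_smul_add_smul_right, cross_self, cross_self,
    cross_swap_args v w]
  ring

end HalvingLines

/-! ### The main theorem. -/

open HalvingLines in
theorem mainTheorem3 (S : Finset Plane) (hEven : Even S.card)
    (hGen : HalvingLines.GeneralPosition S) (a b c d C : Plane)
    (hC : HalvingLines.IsCrossing S a b c d C) :
    ∃ f : Plane → Sym2 Plane,
      (∀ u, HalvingLines.IsOrientation S u →
        ∀ P, HalvingLines.IsCharged S u s(a, b) s(c, d) C P ↔ P = f u) ∧
      (HalvingLines.bisectors a b c d).ncard = 4 ∧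
      Set.InjOn f {u ∈ HalvingLines.bisectors a b c d | HalvingLines.IsOrientation S u} ∧
      4 ≤ (f '' {u | HalvingLines.IsOrientation S u}).encard := by
  have hex : ∀ u, ∃ P, IsOrientation S u → IsCharged S u s(a, b) s(c, d) C P := by
    intro u
    by_cases hu : IsOrientation S u
    · obtain ⟨P, hP⟩ := exists_isCharged hEven hGen hu hC
      exact ⟨P, fun _ => hP⟩
    -- An arbitrary value: `f` is only examined at orientations.
    · exact ⟨s(a, b), fun h => absurd h hu⟩
  choose f hf using hex
  have hk := hC.cross_ne_zero hGen
  have hwedge : ∀ u u', IsOrientation S u → IsOrientation S u' → f u = f u' →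
      0 < cross (b - a) u * cross (d - c) u * (cross (b - a) u' * cross (d - c) u') :=
    fun u u' hu hu' h => same_wedge_of_isCharged hEven hGen hu hu' hC (hf u hu) (h ▸ hf u' hu')
  have hneg : ∀ u, IsOrientation S u → f u ≠ f (-u) := fun u hu h =>
    not_isCharged_neg hEven hGen hu hC (hf u hu) (h ▸ hf _ hu.neg)
  refine ⟨f, fun u hu P => ⟨fun h => isCharged_unique hEven hGen hu hC h (hf u hu),
    fun h => h ▸ hf u hu⟩, ncard_bisectors hk, ?_, ?_⟩
  · rintro u ⟨⟨σ, τ, hσ, hτ, hu⟩, hu₁⟩ u' ⟨⟨σ', τ', hσ', hτ', hu'⟩, hu₁'⟩ h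
    have hw := hwedge u u' hu₁ hu₁' h
    have hne : u' ≠ -u := by
      rintro rfl
      exact hneg u hu₁ h
    have hpos : 0 < ‖b - a‖ ∧ 0 < ‖d - c‖ := by
      refine ⟨norm_pos_iff.2 (sub_ne_zero.2 hC.1.ne.symm),
        norm_pos_iff.2 (sub_ne_zero.2 hC.2.1.ne.symm)⟩
    -- Two bisectors in the same double wedge are equal or opposite, and opposite ones have
    -- different pairs.
    have hsgn : 0 < σ * τ * (σ' * τ') := by
      rw [hu, hu', wedge_smul_add_smul, wedge_smul_add_smul] at hw
      have e : -(σ / ‖b - a‖ * (τ / ‖d - c‖) * cross (b - a) (d - c) ^ 2) *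
          -(σ' / ‖b - a‖ * (τ' / ‖d - c‖) * cross (b - a) (d - c) ^ 2) =
          σ * τ * (σ' * τ') * (cross (b - a) (d - c) ^ 2 / (‖b - a‖ * ‖d - c‖)) ^ 2 := by
        ring
      rw [e] at hw
      exact pos_of_mul_pos_left hw (sq_nonneg _)
    have hneg' : ∀ σ τ : ℝ, ((-σ) / ‖b - a‖) • (b - a) + ((-τ) / ‖d - c‖) • (d - c) =
        -((σ / ‖b - a‖) • (b - a) + (τ / ‖d - c‖) • (d - c)) := by
      intro σ τ
      rw [neg_div, neg_div, neg_smul, neg_smul, neg_add]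
    have hcase : (σ' = σ ∧ τ' = τ) ∨ (σ' = -σ ∧ τ' = -τ) := by
      rcases hσ with rfl | rfl <;> rcases hτ with rfl | rfl <;> rcases hσ' with rfl | rfl <;>
        rcases hτ' with rfl | rfl <;>
        first | (exfalso; norm_num at hsgn; done) | norm_num
    rcases hcase with ⟨rfl, rfl⟩ | ⟨rfl, rfl⟩
    · rw [hu, hu']
    · rw [hneg', ← hu] at hu'
      exact absurd hu' hne
  -- A positive and a negative multiplier give orientations in different double wedges; with their
  -- opposites they yield four pairs even when bisectors are parallel to edges.
  · obtain ⟨s, hs, hs₁⟩ := exists_isOrientation S hk (Set.Ioi_infinite (0 : ℝ))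
    obtain ⟨t, ht, ht₁⟩ := exists_isOrientation S hk (Set.Iio_infinite (0 : ℝ))
    have hsw := wedge_smul_add_smul 1 s (b - a) (d - c)
    have htw := wedge_smul_add_smul 1 t (b - a) (d - c)
    set u₁ := (1 : ℝ) • (b - a) + s • (d - c)
    set u₂ := (1 : ℝ) • (b - a) + t • (d - c)
    have hk2 : 0 < cross (b - a) (d - c) ^ 2 := sq_pos_of_ne_zero hk
    have hprod : cross (b - a) u₁ * cross (d - c) u₁ *
        (cross (b - a) u₂ * cross (d - c) u₂) < 0 := by
      rw [hsw, htw]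
      have h1 := mul_pos hs hk2
      have h2 := mul_neg_of_neg_of_pos ht hk2
      nlinarith [mul_neg_of_pos_of_neg h1 h2]
    have hd : ∀ v w, (v = u₁ ∨ v = -u₁) → (w = u₂ ∨ w = -u₂) → f v ≠ f w := by
      rintro v w hv hw h
      have h1 := hwedge v w (by rcases hv with rfl | rfl; exacts [hs₁, hs₁.neg])
        (by rcases hw with rfl | rfl; exacts [ht₁, ht₁.neg]) h
      rcases hv with rfl | rfl <;> rcases hw with rfl | rfl <;>
        (try simp only [cross_neg_right, neg_mul_neg] at h1) <;> exact h1.not_gt hprod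
    have hsub : ({f u₁, f (-u₁), f u₂, f (-u₂)} : Set (Sym2 Plane)) ⊆
        f '' {u | IsOrientation S u} := by
      rintro P (rfl | rfl | rfl | rfl)
      exacts [⟨_, hs₁, rfl⟩, ⟨_, hs₁.neg, rfl⟩, ⟨_, ht₁, rfl⟩, ⟨_, ht₁.neg, rfl⟩]
    refine le_trans (le_of_eq ?_) (Set.encard_le_encard hsub)
    rw [Set.encard_insert_of_notMem, Set.encard_insert_of_notMem, Set.encard_pair (hneg u₂ ht₁)]
    · norm_num
    · rintro (h | h)
      exacts [hd _ _ (Or.inr rfl) (Or.inl rfl) h, hd _ _ (Or.inr rfl) (Or.inr rfl) h]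
    · rintro (h | h | h)
      exacts [hneg u₁ hs₁ h, hd _ _ (Or.inl rfl) (Or.inl rfl) h, hd _ _ (Or.inl rfl) (Or.inr rfl) h]
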